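/- **Setting.** Let $0<r\le\min\{p_1,p_2\}$, let $f:\mathbb R^{p_1\times p_2}\to\mathbb R$ be twice continuously differentiable and let $\mu>0$. For $L\in\mathbb R^{p_1\times r}$, $R\in\mathbb R^{p_2\times r}$ put $$g(L,R)=f(LR^\top),\qquad g_{\rm reg}(L,R)=f(LR^\top)+\tfrac{\mu}{2}\|L^\top L-R^\top R\|_F^2 ,$$ regarded as functions of the stacked matrix $[L;R]\in\mathbb R^{(p_1+p_2)\times r}$. All matrix spaces carry the inner product $\langle A,B\rangle={\rm trace}(A^\top B)$. $\nabla$ and $\nabla^2$ are the Euclidean gradient and Hessian, $\nabla^2 g[A,B]=\langle\nabla^2 g[A],B\rangle$. $\mathcal M_r$ is the embedded submanifold of the matrices of rank $r$ in $\mathbb R^{p_1\times p_2}$ with the induced metric, $T_X\mathcal M_r$ its tangent space at $X$, and ${\rm Hess} f(X)$ the Riemannian Hessian of $f|_{\mathcal M_r}$ at $X$, a linear operator on $T_X\mathcal M_r$. $\sigma_i$ denotes the $i$th largest singular value, $\lambda_i$ the $i$th largest eigenvalue (with multiplicity) and $\lambda_{\min}$ the least one. Suppose that $X=LR^\top$ has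 rank $r$ and that $\nabla g_{\rm reg}(L,R)=0$. For $A=[A_L;A_R]\in\mathbb R^{(p_1+p_2)\times r}$ put $b(A)=L^\top A_L+A_L^\top L-R^\top A_R-A_R^\top R$. **Theorem.** (1) $L^\top L=R^\top R$, $\nabla g_{\rm reg}(L,R)=\nabla g(L,R)$, and for all $A$ $$\nabla^2 g_{\rm reg}(L,R)[A,A]=\nabla^2 g(L,R)[A,A]+\mu\|b(A)\|_F^2 .$$ (2) Let $X=U\Sigma V^\top$ be a singular value decomposition ($\Sigma\in\mathbb R^{r\times r}$ diagonal with positive nonincreasing diagonal), let $[U\ U_\perp]$ and $[V\ V_\perp]$ be orthogonal, and $P_1=U^\top L$, $P_2=V^\top R$. Define $$\xi^A=[U\ U_\perp]\begin{bmatrix}P_1A_R^\top V+U^\top A_LP_2^\top & P_1A_R^\top V_\perp\\ U_\perp^\top A_LP_2^\top & 0\end{bmatrix}[V\ V_\perp]^\top,$$ $$\mathscr S=\{S\in\mathbb R^{r\times r}: P_1^\top SP_2^{-\top}+(P_1^\top SP_2^{-\top})^\top+P_1^{-1}SP_2+(P_1^{-1}SP_2)^\top=0\},$$ $$\widetilde{\mathscr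 A}_{\rm null}=\{[\,USP_2^{-\top};\,-VS^\top P_1^{-\top}]:S\in\mathscr S\},$$ and let $\mathscr A_{\overline{\rm null}}$ (respectively $\widetilde{\mathscr A}_{\overline{\rm null}}$) be the space of all $$[\,(US_1P_2P_2^\top+U_\perp D_1)P_2^{-\top};\ (VS_2^\top P_1P_1^\top+V_\perp D_2)P_1^{-\top}\,]$$ with $S_1,S_2\in\mathbb R^{r\times r}$, $D_1\in\mathbb R^{(p_1-r)\times r}$, $D_2\in\mathbb R^{(p_2-r)\times r}$ and $S_1=S_2$ (respectively $S_1-S_2\perp\mathscr S$). Then: * for all $A\in\mathbb R^{(p_1+p_2)\times r}$, $\xi^A\in T_X\mathcal M_r$ and $\nabla^2 g_{\rm reg}(L,R)[A,A]={\rm Hess}f(X)[\xi^A,\xi^A]+\mu\|b(A)\|_F^2$; * $\mathcal L:A\mapsto\xi^A$ is a linear bijection from $\mathscr A_{\overline{\rm null}}$ onto $T_X\mathcal M_r$, and ${\rm Hess}f(X)[\xi,\xi]=\nabla^2 g_{\rm reg}(L,R)[\mathcal L^{-1}(\xi),\mathcal L^{-1}(\xi)]$ for all $\xi\in T_X\mathcal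 M_r$; * $\nabla^2 g_{\rm reg}(L,R)[A]=0$ for all $A\in\widetilde{\mathscr A}_{\rm null}$, and $\dim\widetilde{\mathscr A}_{\rm null}=(r^2-r)/2$; * $\widetilde{\mathcal L}:A\mapsto\xi^A$ is a surjective linear map from $\widetilde{\mathscr A}_{\overline{\rm null}}$ onto $T_X\mathcal M_r$, and $\nabla^2 g_{\rm reg}(L,R)[A,A]={\rm Hess}f(X)[\widetilde{\mathcal L}(A),\widetilde{\mathcal L}(A)]+\mu\|b(A)\|_F^2$ for all $A\in\widetilde{\mathscr A}_{\overline{\rm null}}$. (3) ${\rm Hess}f(X)$ and $\nabla^2 g_{\rm reg}(L,R)$ are symmetric operators with $(p_1+p_2-r)r$ and $(p_1+p_2)r$ eigenvalues (with multiplicity), and at least $(r^2-r)/2$ of the latter are zero. Let $N=(p_1+p_2)r-(r^2-r)/2$, and let $\bar\lambda_1\ge\dots\ge\bar\lambda_N$ be the eigenvalues of $\nabla^2 g_{\rm reg}(L,R)$ that remain after $(r^2-r)/2$ zeros are removed. With $\lambda_i=\lambda_i({\rm Hess}f(X))$ and $\lambda_{\min}=\lambda_{\min}({\rm Hess}f(X))$,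 $$\bar\lambda_i\ge\min\{\sigma_r(X)\lambda_i,\,2\sigma_1(X)\lambda_i\}\quad\text{for }1\le i\le(p_1+p_2-r)r,$$ $$\bar\lambda_i\ge\min\{2\sigma_1(X)\lambda_{\min},\,0\}\quad\text{for }(p_1+p_2-r)r+1\le i\le N,$$ $$\bar\lambda_i\le2\sigma_1(X)\bigl(\max\{\lambda_1,0\}+4\mu\bigr)\quad\text{for }1\le i\le(r^2+r)/2,$$ $$\bar\lambda_i\le\max\{2\sigma_1(X)\lambda_{i-(r^2+r)/2},\,\sigma_r(X)\lambda_{i-(r^2+r)/2}\}\quad\text{for }(r^2+r)/2+1\le i\le N.$$ -/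

import Mathlib

open Matrix Module
open scoped Topology ContDiff RealInnerProductSpace Matrix.Norms.Frobenius

/-- The trace inner product `⟨A, B⟩ = trace (Aᵀ B)` on real matrices, compatible with the
Frobenius norm. -/
noncomputable instance frobeniusInnerProductSpace {m n : Type*} [Fintype m] [Fintype n] :
    InnerProductSpace ℝ (Matrix m n ℝ) where
  inner A B := (Aᵀ * B).trace
  norm_sq_eq_re_inner A := by
    rw [Matrix.frobenius_norm_def, ← Real.sqrt_eq_rpow, Real.sq_sqrt (by positivity)]
    simp only [Matrix.trace, Matrix.diag, Matrix.mul_apply, Matrix.transpose_apply, RCLike.re_to_real]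
    rw [Finset.sum_comm]
    refine Finset.sum_congr rfl fun i _ => Finset.sum_congr rfl fun j _ => ?_
    rw [Real.rpow_two, Real.norm_eq_abs, sq_abs, sq]
  conj_inner_symm A B := by
    rw [← Matrix.trace_transpose (Aᵀ * B)]
    simp [Matrix.transpose_mul]
  add_left A B C := by simp [Matrix.add_mul]
  smul_left A B c := by simp

namespace LowRank

/-! ### First and second order objects of Euclidean spaces and of embedded submanifolds -/

section Riemannian

variable {E : Type*} [NormedAddCommGroup E] [InnerProductSpace ℝ E] [FiniteDimensional ℝ E]

/-- The Euclidean Hessian `∇²g(x)`: the derivative at `x` of the Euclidean gradient of `g`.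
The associated bilinear form is `⟪euclHess g x A, B⟫`. -/
noncomputable def euclHess (g : E → ℝ) (x : E) : E →ₗ[ℝ] E :=
  haveI := FiniteDimensional.complete ℝ E
  (fderiv ℝ (gradient g) x : E →L[ℝ] E)

/-- The tangent space at `x` of an embedded submanifold `M` of a Euclidean space: the space of
velocities at time `0` of the smooth curves through `x` that stay in `M` near time `0`. (For a
submanifold these velocities already form a linear space; the span makes this part of the type.) -/
def tangentSpace (M : Set E) (x : E) : Submodule ℝ E :=
  Submodule.span ℝ {ξ | ∃ γ : ℝ → E, ContDiff ℝ ∞ γ ∧ γ 0 = x ∧ (∀ᶠ t in 𝓝 0, γ t ∈ M) ∧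
    HasDerivAt γ ξ 0}

/-- The Riemannian gradient at `x`, for the metric induced by the ambient inner product: the
unique tangent vector with `⟪grad f (x), Z⟫ = D f (x) [Z]` for all tangent vectors `Z`. -/
noncomputable def riemGrad (M : Set E) (f : E → ℝ) (x : E) : tangentSpace M x :=
  (InnerProductSpace.toDual ℝ (tangentSpace M x)).symm
    ((fderiv ℝ f x).comp (tangentSpace M x).subtypeL)

/-- The Riemannian Hessian `Hess f (x) [Z] = ∇_Z grad f` at `x`. The Riemannian connection of an
embedded submanifold with the induced metric is the orthogonal projection to the tangent space of
the directional derivative, along `M`, of the vector field. (On tangent vectors the derivative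
within `M` does not depend on the choice made by `fderivWithin`.) -/
noncomputable def riemHess (M : Set E) (f : E → ℝ) (x : E) :
    tangentSpace M x →ₗ[ℝ] tangentSpace M x :=
  ((tangentSpace M x).orthogonalProjectionOnto ∘L
    (fderivWithin ℝ (fun y => (riemGrad M f y : E)) M x) ∘L (tangentSpace M x).subtypeL :
      tangentSpace M x →L[ℝ] tangentSpace M x)

/-- The eigenvalues of an operator (real here, for the symmetric operators of interest), with
multiplicity. -/
noncomputable def eigs (T : E →ₗ[ℝ] E) : Multiset ℝ := T.charpoly.roots

end Riemannian

/-- The `i`-th largest element (`i = 1, 2, …, card s`), counted with multiplicity. -/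
noncomputable def nthLargest (s : Multiset ℝ) (i : ℕ) : ℝ := (s.sort (· ≥ ·)).getD (i - 1) 0

/-- The least element of a nonempty multiset of reals. -/
noncomputable def least (s : Multiset ℝ) : ℝ := nthLargest s (Multiset.card s)

/-! ### The manifold and the factorization formulations -/

section Problem

variable {p₁ p₂ r : ℕ}

/-- The `i`-th largest singular value `σ_i(X)`, `i = 1, 2, …`. -/
noncomputable def sigma (X : Matrix (Fin p₁) (Fin p₂) ℝ) (i : ℕ) : ℝ :=
  (Matrix.toEuclideanLin X).singularValues (i - 1)

/-- The set of the `p₁ × p₂` matrices of rank `r`. -/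
def rankManifold (p₁ p₂ r : ℕ) : Set (Matrix (Fin p₁) (Fin p₂) ℝ) := {X | X.rank = r}

/-- `g(L, R) = f(L Rᵀ)`, as a function of the stacked matrix `[L; R]`. -/
def gFac (f : Matrix (Fin p₁) (Fin p₂) ℝ → ℝ) (W : Matrix (Fin p₁ ⊕ Fin p₂) (Fin r) ℝ) : ℝ :=
  f (W.toRows₁ * W.toRows₂ᵀ)

/-- `g_reg(L, R) = f(L Rᵀ) + (μ / 2) ‖Lᵀ L - Rᵀ R‖_F²`, as a function of `[L; R]`. -/
noncomputable def gReg (f : Matrix (Fin p₁) (Fin p₂) ℝ → ℝ) (μ : ℝ)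
    (W : Matrix (Fin p₁ ⊕ Fin p₂) (Fin r) ℝ) : ℝ :=
  f (W.toRows₁ * W.toRows₂ᵀ) + μ / 2 * ‖W.toRows₁ᵀ * W.toRows₁ - W.toRows₂ᵀ * W.toRows₂‖ ^ 2

/-- `Lᵀ A_L + A_Lᵀ L - Rᵀ A_R - A_Rᵀ R` for `A = [A_L; A_R]`. -/
def balance (L : Matrix (Fin p₁) (Fin r) ℝ) (R : Matrix (Fin p₂) (Fin r) ℝ)
    (A : Matrix (Fin p₁ ⊕ Fin p₂) (Fin r) ℝ) : Matrix (Fin r) (Fin r) ℝ :=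
  Lᵀ * A.toRows₁ + A.toRows₁ᵀ * L - Rᵀ * A.toRows₂ - A.toRows₂ᵀ * R

/-- `X = U diag(s) Vᵀ` is an economic singular value decomposition of a matrix of rank `r`, and
`U'`, `V'` complete `U`, `V` to orthogonal matrices `[U U']`, `[V V']`. -/
structure IsSVD (X : Matrix (Fin p₁) (Fin p₂) ℝ)
    (U : Matrix (Fin p₁) (Fin r) ℝ) (U' : Matrix (Fin p₁) (Fin (p₁ - r)) ℝ) (s : Fin r → ℝ)
    (V : Matrix (Fin p₂) (Fin r) ℝ) (V' : Matrix (Fin p₂) (Fin (p₂ - r)) ℝ) : Prop where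
  U_orth : Uᵀ * U = 1
  U'_orth : U'ᵀ * U' = 1
  U_perp : Uᵀ * U' = 0
  V_orth : Vᵀ * V = 1
  V'_orth : V'ᵀ * V' = 1
  V_perp : Vᵀ * V' = 0
  s_anti : Antitone s
  s_pos : ∀ i, 0 < s i
  eq : X = U * Matrix.diagonal s * Vᵀ

/-- The matrix `ξ^A_{L,R}`, where `P₁ = Uᵀ L`, `P₂ = Vᵀ R`:
`[U U'] [P₁ A_Rᵀ V + Uᵀ A_L P₂ᵀ, P₁ A_Rᵀ V'; U'ᵀ A_L P₂ᵀ, 0] [V V']ᵀ`. -/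
def xiMat (L : Matrix (Fin p₁) (Fin r) ℝ) (R : Matrix (Fin p₂) (Fin r) ℝ)
    (U : Matrix (Fin p₁) (Fin r) ℝ) (U' : Matrix (Fin p₁) (Fin (p₁ - r)) ℝ)
    (V : Matrix (Fin p₂) (Fin r) ℝ) (V' : Matrix (Fin p₂) (Fin (p₂ - r)) ℝ)
    (A : Matrix (Fin p₁ ⊕ Fin p₂) (Fin r) ℝ) : Matrix (Fin p₁) (Fin p₂) ℝ :=
  fromCols U U' *
    fromBlocks ((Uᵀ * L) * A.toRows₂ᵀ * V + Uᵀ * A.toRows₁ * (Vᵀ * R)ᵀ)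
      ((Uᵀ * L) * A.toRows₂ᵀ * V')
      (U'ᵀ * A.toRows₁ * (Vᵀ * R)ᵀ)
      0 *
    (fromCols V V')ᵀ

/-- The space of the `r × r` matrices `S` with
`P₁ᵀ S P₂⁻ᵀ + (P₁ᵀ S P₂⁻ᵀ)ᵀ + P₁⁻¹ S P₂ + (P₁⁻¹ S P₂)ᵀ = 0`. -/
noncomputable def sSpace (P₁ P₂ : Matrix (Fin r) (Fin r) ℝ) :
    Submodule ℝ (Matrix (Fin r) (Fin r) ℝ) where
  carrier := {S | P₁ᵀ * S * P₂ᵀ⁻¹ + (P₁ᵀ * S * P₂ᵀ⁻¹)ᵀ + P₁⁻¹ * S * P₂ + (P₁⁻¹ * S * P₂)ᵀ = 0}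
  zero_mem' := by simp
  add_mem' {S T} hS hT := by
    have h := congrArg₂ (· + ·) hS hT
    simp only [Set.mem_ofPred_eq, add_zero] at h ⊢
    rw [← h]
    simp only [Matrix.mul_add, Matrix.add_mul, Matrix.transpose_add]
    abel
  smul_mem' c S hS := by
    have h := congrArg (c • ·) hS
    simp only [Set.mem_ofPred_eq, smul_zero] at h ⊢
    rw [← h]
    simp [smul_add]

/-- The space of the matrices `[U S P₂⁻ᵀ; -V Sᵀ P₁⁻ᵀ]` with `S` in `sSpace P₁ P₂`. -/
noncomputable def nullTilde (P₁ P₂ : Matrix (Fin r) (Fin r) ℝ)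
    (U : Matrix (Fin p₁) (Fin r) ℝ) (V : Matrix (Fin p₂) (Fin r) ℝ) :
    Submodule ℝ (Matrix (Fin p₁ ⊕ Fin p₂) (Fin r) ℝ) where
  carrier := {A | ∃ S ∈ sSpace P₁ P₂, A = fromRows (U * S * P₂ᵀ⁻¹) (-(V * Sᵀ * P₁ᵀ⁻¹))}
  zero_mem' := ⟨0, zero_mem _, by ext (i | i) j <;> simp⟩
  add_mem' := by
    rintro _ _ ⟨S, hS, rfl⟩ ⟨T, hT, rfl⟩
    refine ⟨S + T, add_mem hS hT, ?_⟩
    simp only [Matrix.mul_add, Matrix.add_mul, Matrix.transpose_add]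
    ext (i | i) j <;> simp
    ring
  smul_mem' := by
    rintro c _ ⟨S, hS, rfl⟩
    refine ⟨c • S, Submodule.smul_mem _ c hS, ?_⟩
    ext (i | i) j <;> simp

/-- The space of the matrices
`[(U S P₂ P₂ᵀ + U' D₁) P₂⁻ᵀ; (V Sᵀ P₁ P₁ᵀ + V' D₂) P₁⁻ᵀ]` with arbitrary `S`, `D₁`, `D₂`. -/
noncomputable def nullBar (P₁ P₂ : Matrix (Fin r) (Fin r) ℝ)
    (U : Matrix (Fin p₁) (Fin r) ℝ) (U' : Matrix (Fin p₁) (Fin (p₁ - r)) ℝ)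
    (V : Matrix (Fin p₂) (Fin r) ℝ) (V' : Matrix (Fin p₂) (Fin (p₂ - r)) ℝ) :
    Submodule ℝ (Matrix (Fin p₁ ⊕ Fin p₂) (Fin r) ℝ) where
  carrier := {A | ∃ (S : Matrix (Fin r) (Fin r) ℝ) (D₁ : Matrix (Fin (p₁ - r)) (Fin r) ℝ)
    (D₂ : Matrix (Fin (p₂ - r)) (Fin r) ℝ),
    A = fromRows ((U * S * P₂ * P₂ᵀ + U' * D₁) * P₂ᵀ⁻¹) ((V * Sᵀ * P₁ * P₁ᵀ + V' * D₂) * P₁ᵀ⁻¹)}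
  zero_mem' := ⟨0, 0, 0, by ext (i | i) j <;> simp⟩
  add_mem' := by
    rintro _ _ ⟨S, D₁, D₂, rfl⟩ ⟨T, E₁, E₂, rfl⟩
    refine ⟨S + T, D₁ + E₁, D₂ + E₂, ?_⟩
    simp only [Matrix.mul_add, Matrix.add_mul, Matrix.transpose_add]
    ext (i | i) j <;> simp <;> ring
  smul_mem' := by
    rintro c _ ⟨S, D₁, D₂, rfl⟩
    refine ⟨c • S, c • D₁, c • D₂, ?_⟩
    simp only [Matrix.mul_smul, Matrix.smul_mul, Matrix.transpose_smul, ← smul_add]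
    ext (i | i) j <;> simp

/-- The space of the matrices
`[(U S₁ P₂ P₂ᵀ + U' D₁) P₂⁻ᵀ; (V S₂ᵀ P₁ P₁ᵀ + V' D₂) P₁⁻ᵀ]` with arbitrary `D₁`, `D₂` and with
`S₁ - S₂` orthogonal to `sSpace P₁ P₂`. -/
noncomputable def nullBarTilde (P₁ P₂ : Matrix (Fin r) (Fin r) ℝ)
    (U : Matrix (Fin p₁) (Fin r) ℝ) (U' : Matrix (Fin p₁) (Fin (p₁ - r)) ℝ)
    (V : Matrix (Fin p₂) (Fin r) ℝ) (V' : Matrix (Fin p₂) (Fin (p₂ - r)) ℝ) :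
    Submodule ℝ (Matrix (Fin p₁ ⊕ Fin p₂) (Fin r) ℝ) where
  carrier := {A | ∃ (S₁ S₂ : Matrix (Fin r) (Fin r) ℝ) (D₁ : Matrix (Fin (p₁ - r)) (Fin r) ℝ)
    (D₂ : Matrix (Fin (p₂ - r)) (Fin r) ℝ), S₁ - S₂ ∈ (sSpace P₁ P₂)ᗮ ∧
    A = fromRows ((U * S₁ * P₂ * P₂ᵀ + U' * D₁) * P₂ᵀ⁻¹)
      ((V * S₂ᵀ * P₁ * P₁ᵀ + V' * D₂) * P₁ᵀ⁻¹)}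
  zero_mem' := ⟨0, 0, 0, 0, by simp, by ext (i | i) j <;> simp⟩
  add_mem' := by
    rintro _ _ ⟨S₁, S₂, D₁, D₂, hS, rfl⟩ ⟨T₁, T₂, E₁, E₂, hT, rfl⟩
    refine ⟨S₁ + T₁, S₂ + T₂, D₁ + E₁, D₂ + E₂, ?_, ?_⟩
    · rw [add_sub_add_comm]; exact add_mem hS hT
    simp only [Matrix.mul_add, Matrix.add_mul, Matrix.transpose_add]
    ext (i | i) j <;> simp <;> ring
  smul_mem' := by
    rintro c _ ⟨S₁, S₂, D₁, D₂, hS, rfl⟩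
    refine ⟨c • S₁, c • S₂, c • D₁, c • D₂, ?_, ?_⟩
    · rw [← smul_sub]; exact Submodule.smul_mem _ c hS
    simp only [Matrix.mul_smul, Matrix.smul_mul, Matrix.transpose_smul, ← smul_add]
    ext (i | i) j <;> simp

end Problem

end LowRank

open LowRank

/-!
The map `[L; R] ↦ L Rᵀ` is a submersion onto the manifold of matrices of rank `r` near a point with
`L`, `R` of full column rank, with differential `τ(A) = L A_Rᵀ + A_L Rᵀ` (`facDeriv`). The range of
`τ` is the tangent space (`tangentSpace_rankManifold`); its kernel consists of the `[L N; -R Nᵀ]`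
(`ker_facDeriv`).

A critical point of the regularized function is balanced: its derivative in the direction
`[L Δ; -R Δ]` with `Δ = Lᵀ L - Rᵀ R` is a multiple of `‖L Δ‖² + ‖R Δ‖²`
(`balanced_of_gradient_eq_zero`). Hence it is a critical point of `g`, and `L Rᵀ` is a critical
point of `f` on the manifold. At a critical point second derivatives transform as quadratic forms,
so `⟪Hess f τ(A), τ(B)⟫ = ⟪∇²g A, B⟫` (`inner_riemHess_facDeriv`). This only needs the Riemannian
gradient to be differentiable within the manifold, for which it is written, near a given point,
through projections onto the column and the row space of `Y = a(Y) b(Y)ᵀ`, where `a` and `b` depend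
smoothly on `Y`. The regularizer adds `μ ⟪b(A), b(B)⟫` (`inner_euclHess_gReg`).

In a singular value decomposition `ξ^A` is `τ(A)` (`xiMat_eq_facDeriv`), `nullBar` is the
orthogonal complement of `ker τ` (`nullBar_eq_ker_orthogonal`), and `nullTilde` is the space of the
`[L M; R M]` with `M` skew-symmetric (`nullTilde_eq_orbitSpace`), on which both `τ` and `b` vanish.
This gives the statements on `∇²g_reg`.

For the eigenvalues, `b` vanishes on `(ker τ)ᗮ`, and there
`σ_r ‖A‖² ≤ ‖τ(A)‖² ≤ 2 σ_1 ‖A‖²`, as the eigenvalues of `Lᵀ L = Rᵀ R` are singular values of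
`L Rᵀ`. The bounds follow from the Courant-Fischer principle on the orthogonal complement of the
space of the `[L M; R M]`, whose removal takes away `(r² - r) / 2` zero eigenvalues
(`eigenvalue_comparison`).
-/

namespace LowRank

/-- The topology of the Frobenius norm. It is the product topology, but not reducibly so: this
instance lets the calculus of normed spaces and matrix-valued curves meet in one topology. -/
noncomputable local instance (priority := 2000) frobeniusTopology {m n : Type*}
    [Fintype m] [Fintype n] :
    TopologicalSpace (Matrix m n ℝ) :=
  PseudoMetricSpace.toUniformSpace.toTopologicalSpace

/-! ### The trace inner product and calculus with matrices -/

section MatrixCalculus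

variable {l m n : Type*} [Fintype l] [Fintype m] [Fintype n]

theorem inner_eq_trace (A B : Matrix m n ℝ) : ⟪A, B⟫ = (Aᵀ * B).trace := rfl

theorem inner_mul_left_eq (A : Matrix l m ℝ) (B : Matrix m n ℝ) (C : Matrix l n ℝ) :
    ⟪A * B, C⟫ = ⟪B, Aᵀ * C⟫ := by
  simp only [inner_eq_trace, transpose_mul, Matrix.mul_assoc]

theorem inner_mul_right_eq (A : Matrix l m ℝ) (B : Matrix m n ℝ) (C : Matrix l n ℝ) :
    ⟪A * B, C⟫ = ⟪A, C * Bᵀ⟫ := by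
  simp only [inner_eq_trace, transpose_mul, Matrix.mul_assoc]
  rw [Matrix.trace_mul_comm, Matrix.mul_assoc]

theorem inner_transpose_transpose (A B : Matrix m n ℝ) : ⟪Aᵀ, Bᵀ⟫ = ⟪A, B⟫ := by
  rw [real_inner_comm, inner_eq_trace, inner_eq_trace, transpose_transpose, Matrix.trace_mul_comm]

theorem inner_eq_toRows (A B : Matrix (m ⊕ n) l ℝ) :
    ⟪A, B⟫ = ⟪A.toRows₁, B.toRows₁⟫ + ⟪A.toRows₂, B.toRows₂⟫ := by
  conv_lhs => rw [← fromRows_toRows A, ← fromRows_toRows B]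
  simp only [inner_eq_trace, transpose_fromRows, fromCols_mul_fromRows, Matrix.trace_add]

/-- Multiplication of matrices as a continuous bilinear map. -/
noncomputable def mulCLM : Matrix l m ℝ →L[ℝ] Matrix m n ℝ →L[ℝ] Matrix l n ℝ :=
  LinearMap.mkContinuous₂ (mulLinearMap ℝ) 1 fun A B => by
    simpa using frobenius_norm_mul A B

theorem mulCLM_apply (A : Matrix l m ℝ) (B : Matrix m n ℝ) : mulCLM A B = A * B := rfl

variable {E : Type*} [NormedAddCommGroup E] [NormedSpace ℝ E]

theorem contDiff_matMul {k : ℕ∞ω} {A : E → Matrix l m ℝ} {B : E → Matrix m n ℝ}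
    (hA : ContDiff ℝ k A) (hB : ContDiff ℝ k B) : ContDiff ℝ k fun x => A x * B x := by
  have h : ContDiff ℝ k fun x => (mulCLM (A x) : Matrix m n ℝ →L[ℝ] Matrix l n ℝ) :=
    (mulCLM (l := l) (m := m) (n := n)).contDiff.comp hA
  exact h.clm_apply hB

theorem differentiableAt_matMul {x : E} {A : E → Matrix l m ℝ} {B : E → Matrix m n ℝ}
    (hA : DifferentiableAt ℝ A x) (hB : DifferentiableAt ℝ B x) :
    DifferentiableAt ℝ (fun x => A x * B x) x :=
  DifferentiableAt.clm_apply (c := fun x => mulCLM (A x)) (mulCLM.differentiableAt.comp x hA) hB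

theorem hasDerivAt_matMul {t : ℝ} {A : ℝ → Matrix l m ℝ} {B : ℝ → Matrix m n ℝ}
    {A' : Matrix l m ℝ} {B' : Matrix m n ℝ}
    (hA : HasDerivAt A A' t) (hB : HasDerivAt B B' t) :
    HasDerivAt (fun t => A t * B t) (A' * B t + A t * B') t := by
  have h : HasDerivAt (fun t => (mulCLM (A t) : Matrix m n ℝ →L[ℝ] Matrix l n ℝ)) (mulCLM A') t :=
    mulCLM.hasFDerivAt.comp_hasDerivAt t hA
  have h2 := h.clm_apply hB
  simpa only [mulCLM_apply] using h2

/-- Transposition as a continuous linear map. -/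
noncomputable def transposeCLM : Matrix m n ℝ →L[ℝ] Matrix n m ℝ :=
  LinearMap.toContinuousLinearMap (transposeLinearEquiv m n ℝ ℝ).toLinearMap

theorem transposeCLM_apply (A : Matrix m n ℝ) : transposeCLM A = Aᵀ := rfl

theorem contDiff_transpose {k : ℕ∞ω} {A : E → Matrix m n ℝ} (hA : ContDiff ℝ k A) :
    ContDiff ℝ k fun x => (A x)ᵀ := by
  simpa only [transposeCLM_apply, Function.comp_def] using transposeCLM.contDiff.comp hA

theorem differentiableAt_transpose {x : E} {A : E → Matrix m n ℝ}
    (hA : DifferentiableAt ℝ A x) : DifferentiableAt ℝ (fun x => (A x)ᵀ) x := by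
  have h := (transposeCLM (m := m) (n := n)).differentiableAt (x := A x)
  simpa only [transposeCLM_apply, Function.comp_def] using h.comp x hA

theorem hasDerivAt_transpose {t : ℝ} {A : ℝ → Matrix m n ℝ} {A' : Matrix m n ℝ}
    (hA : HasDerivAt A A' t) : HasDerivAt (fun t => (A t)ᵀ) A'ᵀ t := by
  have h := (transposeCLM (m := m) (n := n)).hasFDerivAt (x := A t)
  simpa only [transposeCLM_apply, Function.comp_def] using h.comp_hasDerivAt t hA

/-- The upper block of a stacked matrix, as a continuous linear map. -/
noncomputable def toRows₁CLM : Matrix (l ⊕ m) n ℝ →L[ℝ] Matrix l n ℝ :=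
  LinearMap.toContinuousLinearMap
    { toFun := toRows₁, map_add' := fun _ _ => rfl, map_smul' := fun _ _ => rfl }

/-- The lower block of a stacked matrix, as a continuous linear map. -/
noncomputable def toRows₂CLM : Matrix (l ⊕ m) n ℝ →L[ℝ] Matrix m n ℝ :=
  LinearMap.toContinuousLinearMap
    { toFun := toRows₂, map_add' := fun _ _ => rfl, map_smul' := fun _ _ => rfl }

theorem contDiff_toRows₁ {k : ℕ∞ω} : ContDiff ℝ k (toRows₁ : Matrix (l ⊕ m) n ℝ → _) :=
  (toRows₁CLM (l := l) (m := m) (n := n)).contDiff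

theorem contDiff_toRows₂ {k : ℕ∞ω} : ContDiff ℝ k (toRows₂ : Matrix (l ⊕ m) n ℝ → _) :=
  (toRows₂CLM (l := l) (m := m) (n := n)).contDiff

theorem differentiableAt_matInv [DecidableEq n] {x : E} {A : E → Matrix n n ℝ}
    (hA : DifferentiableAt ℝ A x) (hx : IsUnit (A x)) :
    DifferentiableAt ℝ (fun x => (A x)⁻¹) x := by
  have : (fun x => (A x)⁻¹) = fun x => Ring.inverse (A x) := by
    funext y; rw [nonsing_inv_eq_ringInverse]
  rw [this]
  have : CompleteSpace (Matrix n n ℝ) := FiniteDimensional.complete ℝ _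
  obtain ⟨u, hu⟩ := hx
  have h := (differentiableAt_inverse (𝕜 := ℝ) (x := A x) ⟨u, hu⟩)
  exact h.comp x hA

theorem eventually_isUnit [DecidableEq n] {X : Type*} [TopologicalSpace X] {x : X}
    {A : X → Matrix n n ℝ} (hA : ContinuousAt A x) (hx : IsUnit (A x)) :
    ∀ᶠ y in 𝓝 x, IsUnit (A y) := by
  have : CompleteSpace (Matrix n n ℝ) := FiniteDimensional.complete ℝ _
  exact hA.eventually (Units.isOpen.mem_nhds hx)

theorem hasDerivAt_line {V : Type*} [NormedAddCommGroup V] [NormedSpace ℝ V] (a b : V) (t : ℝ) :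
    HasDerivAt (fun s : ℝ => a + s • b) b t := by
  simpa using ((hasDerivAt_id t).smul_const b).const_add a

end MatrixCalculus

/-! ### Euclidean Hessians -/

section EuclideanHessian

variable {E : Type*} [NormedAddCommGroup E] [InnerProductSpace ℝ E]

theorem inner_gradient_eq_fderiv [CompleteSpace E] (g : E → ℝ) (x v : E) :
    ⟪gradient g x, v⟫ = fderiv ℝ g x v := by
  simp [gradient]

variable [FiniteDimensional ℝ E]

/-- The bilinear form of the Euclidean Hessian is a directional derivative of the differential. -/
theorem hasDerivAt_fderiv_line {g : E → ℝ} (hg : ContDiff ℝ 2 g) (x a b : E) :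
    HasDerivAt (fun t : ℝ => fderiv ℝ g (x + t • a) b) ⟪euclHess g x a, b⟫ 0 := by
  have := FiniteDimensional.complete ℝ E
  have hd : Differentiable ℝ (fderiv ℝ g) :=
    (hg.fderiv_right (m := 1) (by norm_num)).differentiable (by norm_num)
  have hgr : DifferentiableAt ℝ (gradient g) x :=
    (InnerProductSpace.toDual ℝ E).symm.differentiableAt.comp x (hd x)
  have hl := hasDerivAt_line x a 0
  have h1 : HasFDerivAt (gradient g) (fderiv ℝ (gradient g) x) (x + (0 : ℝ) • a) := by
    simpa using hgr.hasFDerivAt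
  have h2 := (h1.comp_hasDerivAt (0 : ℝ) hl).inner ℝ (hasDerivAt_const (0 : ℝ) b)
  simpa [inner_gradient_eq_fderiv, euclHess, Function.comp_def] using h2

theorem euclHess_isSymmetric {g : E → ℝ} (hg : ContDiff ℝ 2 g) (x : E) :
    (euclHess g x).IsSymmetric := by
  intro a b
  have hd : Differentiable ℝ (fderiv ℝ g) :=
    (hg.fderiv_right (m := 1) (by norm_num)).differentiable (by norm_num)
  have key : ∀ a b, ⟪euclHess g x a, b⟫ = fderiv ℝ (fderiv ℝ g) x a b := by
    intro a b
    refine (hasDerivAt_fderiv_line hg x a b).unique ?_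
    have h1 : HasFDerivAt (fderiv ℝ g) (fderiv ℝ (fderiv ℝ g) x) (x + (0 : ℝ) • a) := by
      simpa using (hd x).hasFDerivAt
    have h2 := h1.comp_hasDerivAt (0 : ℝ) (hasDerivAt_line x a 0)
    simpa [Function.comp_def] using h2.clm_apply (hasDerivAt_const (0 : ℝ) b)
  have hs : fderiv ℝ (fderiv ℝ g) x a b = fderiv ℝ (fderiv ℝ g) x b a :=
    ContDiffAt.isSymmSndFDerivAt hg.contDiffAt (by simp) a b
  rw [key, hs, ← key, real_inner_comm]

end EuclideanHessian

/-! ### The Courant-Fischer principle -/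

section CourantFischer

variable {E : Type*} [NormedAddCommGroup E] [InnerProductSpace ℝ E]

theorem inner_sum_eigen (T : E →ₗ[ℝ] E) {n : ℕ} (b : OrthonormalBasis (Fin n) ℝ E) (ev : Fin n → ℝ)
    (hb : ∀ i, T (b i) = ev i • b i) (x : E) :
    ⟪T x, x⟫ = ∑ i, ev i * ⟪b i, x⟫ ^ 2 := by
  have hx : T x = ∑ i, (⟪b i, x⟫ * ev i) • b i := by
    conv_lhs => rw [← b.sum_repr' x]
    simp [map_sum, hb, smul_smul]
  rw [hx, sum_inner]
  refine Finset.sum_congr rfl fun i _ => ?_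
  rw [real_inner_smul_left]
  ring

theorem norm_sq_eq_sum_inner {n : ℕ} (b : OrthonormalBasis (Fin n) ℝ E) (x : E) :
    ‖x‖ ^ 2 = ∑ i, ⟪b i, x⟫ ^ 2 := by
  simpa using (b.sum_sq_norm_inner_right x).symm

theorem inner_eq_zero_of_mem_span {n : ℕ} (b : OrthonormalBasis (Fin n) ℝ E) (S : Set (Fin n))
    {x : E} (hx : x ∈ Submodule.span ℝ (b '' S)) {i : Fin n} (hi : i ∉ S) : ⟪b i, x⟫ = 0 := by
  induction hx using Submodule.span_induction with
  | mem x h =>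
    obtain ⟨j, hj, rfl⟩ := h
    exact b.orthonormal.2 fun h => hi (h ▸ hj)
  | zero => simp
  | add x y _ _ hx hy => rw [inner_add_right, hx, hy, add_zero]
  | smul c x _ hx => rw [real_inner_smul_right, hx, mul_zero]

theorem finrank_span_image {n : ℕ} (b : OrthonormalBasis (Fin n) ℝ E) (S : Finset (Fin n)) :
    finrank ℝ (Submodule.span ℝ (b '' (S : Set (Fin n)))) = S.card := by
  classical
  rw [← Finset.coe_image, finrank_span_finset_eq_card, Finset.card_image_of_injective]
  · exact b.orthonormal.linearIndependent.injective
  · rw [Finset.coe_image]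
    exact (b.orthonormal.linearIndependent.linearIndepOn S).id_image

variable [FiniteDimensional ℝ E] {T : E →ₗ[ℝ] E}

theorem eigs_card (hT : T.IsSymmetric) : (eigs T).card = finrank ℝ E := by
  rw [eigs, hT.roots_charpoly_eq_eigenvalues rfl]
  simp

theorem nthLargest_eigs (hT : T.IsSymmetric) {n : ℕ} (hn : finrank ℝ E = n) (i : Fin n) :
    nthLargest (eigs T) (i + 1) = hT.eigenvalues hn i := by
  have h := hT.sort_roots_charpoly_eq_eigenvalues hn
  simp only [nthLargest, eigs, add_tsub_cancel_right]
  have h' : (T.charpoly.roots.sort (· ≥ ·)) = List.ofFn (hT.eigenvalues hn) := by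
    simpa using h
  rw [h', List.getD_eq_getElem _ _ (by simp)]
  simp

theorem exists_ne_zero_mem_inf {V W : Submodule ℝ E} (h : finrank ℝ E < finrank ℝ V + finrank ℝ W) :
    ∃ x ∈ V, x ∈ W ∧ x ≠ 0 := by
  have h1 := Submodule.finrank_sup_add_finrank_inf_eq V W
  have h2 := Submodule.finrank_le (V ⊔ W)
  have h3 : 0 < finrank ℝ (V ⊓ W : Submodule ℝ E) := by omega
  obtain ⟨x, hx, hne⟩ := Submodule.exists_mem_ne_zero_of_ne_bot
    (Submodule.one_le_finrank_iff.mp h3)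
  exact ⟨x, hx.1, hx.2, hne⟩


/-- There is an `i`-dimensional space on which the quadratic form is at least the `i`-th largest
eigenvalue. -/
theorem exists_submodule_nthLargest_le (hT : T.IsSymmetric) {i : ℕ} (h1 : 1 ≤ i)
    (hi : i ≤ finrank ℝ E) :
    ∃ V : Submodule ℝ E, finrank ℝ V = i ∧
      ∀ x ∈ V, nthLargest (eigs T) i * ‖x‖ ^ 2 ≤ ⟪T x, x⟫ := by
  obtain ⟨k, rfl⟩ : ∃ k, i = k + 1 := ⟨i - 1, by omega⟩
  let k' : Fin (finrank ℝ E) := ⟨k, hi⟩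
  let b := hT.eigenvectorBasis rfl
  refine ⟨Submodule.span ℝ (b '' (Finset.Iic k' : Finset _)), ?_, fun x hx => ?_⟩
  · rw [finrank_span_image, Fin.card_Iic]
  · rw [inner_sum_eigen T b (hT.eigenvalues rfl) (fun i => hT.apply_eigenvectorBasis rfl i),
      norm_sq_eq_sum_inner b, Finset.mul_sum]
    refine Finset.sum_le_sum fun j _ => ?_
    by_cases hj : j ∈ Finset.Iic k'
    · rw [show k + 1 = (k' : ℕ) + 1 from rfl, nthLargest_eigs hT rfl]
      exact mul_le_mul_of_nonneg_right (hT.eigenvalues_antitone rfl (Finset.mem_Iic.mp hj))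
        (sq_nonneg _)
    · rw [inner_eq_zero_of_mem_span b _ hx (by simpa using hj)]
      simp

/-- There is a space of codimension `i - 1` on which the quadratic form is at most the `i`-th
largest eigenvalue. -/
theorem exists_submodule_le_nthLargest (hT : T.IsSymmetric) {i : ℕ} (h1 : 1 ≤ i)
    (hi : i ≤ finrank ℝ E) :
    ∃ V : Submodule ℝ E, finrank ℝ V + i = finrank ℝ E + 1 ∧
      ∀ x ∈ V, ⟪T x, x⟫ ≤ nthLargest (eigs T) i * ‖x‖ ^ 2 := by
  obtain ⟨k, rfl⟩ : ∃ k, i = k + 1 := ⟨i - 1, by omega⟩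
  let k' : Fin (finrank ℝ E) := ⟨k, hi⟩
  let b := hT.eigenvectorBasis rfl
  refine ⟨Submodule.span ℝ (b '' (Finset.Ici k' : Finset _)), ?_, fun x hx => ?_⟩
  · rw [finrank_span_image, Fin.card_Ici]
    simp only [k']
    omega
  · rw [inner_sum_eigen T b (hT.eigenvalues rfl) (fun i => hT.apply_eigenvectorBasis rfl i),
      norm_sq_eq_sum_inner b, Finset.mul_sum]
    refine Finset.sum_le_sum fun j _ => ?_
    by_cases hj : j ∈ Finset.Ici k'
    · rw [show k + 1 = (k' : ℕ) + 1 from rfl, nthLargest_eigs hT rfl]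
      exact mul_le_mul_of_nonneg_right (hT.eigenvalues_antitone rfl (Finset.mem_Ici.mp hj))
        (sq_nonneg _)
    · rw [inner_eq_zero_of_mem_span b _ hx (by simpa using hj)]
      simp

/-- A lower bound from the Courant-Fischer principle: the space `V` meets the space of codimension
`i - 1` given by `exists_submodule_le_nthLargest`. -/
theorem le_nthLargest_of_submodule (hT : T.IsSymmetric) {i : ℕ} (h1 : 1 ≤ i) {c : ℝ}
    (V : Submodule ℝ E) (hV : i ≤ finrank ℝ V) (h : ∀ x ∈ V, c * ‖x‖ ^ 2 ≤ ⟪T x, x⟫) :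
    c ≤ nthLargest (eigs T) i := by
  obtain ⟨W, hW, hWle⟩ :=
    exists_submodule_le_nthLargest hT h1 (hV.trans (Submodule.finrank_le V))
  obtain ⟨x, hxV, hxW, hx⟩ := exists_ne_zero_mem_inf (V := V) (W := W) (by omega)
  exact le_of_mul_le_mul_right ((h x hxV).trans (hWle x hxW)) (by positivity)

/-- An upper bound from the Courant-Fischer principle: the space `V` meets the `i`-dimensional space
given by `exists_submodule_nthLargest_le`. -/
theorem nthLargest_le_of_submodule (hT : T.IsSymmetric) {i : ℕ} (h1 : 1 ≤ i)
    (hi : i ≤ finrank ℝ E) {c : ℝ} (V : Submodule ℝ E) (hV : finrank ℝ E + 1 ≤ finrank ℝ V + i)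
    (h : ∀ x ∈ V, ⟪T x, x⟫ ≤ c * ‖x‖ ^ 2) :
    nthLargest (eigs T) i ≤ c := by
  obtain ⟨W, hW, hWle⟩ := exists_submodule_nthLargest_le hT h1 hi
  obtain ⟨x, hxV, hxW, hx⟩ := exists_ne_zero_mem_inf (V := V) (W := W) (by omega)
  exact le_of_mul_le_mul_right ((hWle x hxW).trans (h x hxV)) (by positivity)

theorem least_eigs_mul_le (hT : T.IsSymmetric) (hpos : 1 ≤ finrank ℝ E) (x : E) :
    least (eigs T) * ‖x‖ ^ 2 ≤ ⟪T x, x⟫ := by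
  obtain ⟨V, hV, hle⟩ := exists_submodule_nthLargest_le hT hpos le_rfl
  rw [least, eigs_card hT]
  exact hle x (Submodule.eq_top_of_finrank_eq hV ▸ Submodule.mem_top)

theorem inner_le_nthLargest_one (hT : T.IsSymmetric) (hpos : 1 ≤ finrank ℝ E) (x : E) :
    ⟪T x, x⟫ ≤ nthLargest (eigs T) 1 * ‖x‖ ^ 2 := by
  obtain ⟨V, hV, hle⟩ := exists_submodule_le_nthLargest hT le_rfl hpos
  exact hle x (Submodule.eq_top_of_finrank_eq (by omega : finrank ℝ V = finrank ℝ E) ▸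
    Submodule.mem_top)

/-- The operator induced on the orthogonal complement of a subspace of its kernel has the same
eigenvalues, except for as many zeros as the dimension of the subspace. -/
theorem exists_restrict_orthogonal (hT : T.IsSymmetric) (N : Submodule ℝ E)
    (hN : ∀ x ∈ N, T x = 0) :
    ∃ T' : Nᗮ →ₗ[ℝ] Nᗮ, T'.IsSymmetric ∧ (∀ x, (T' x : E) = T x) ∧
      eigs T = Multiset.replicate (finrank ℝ N) 0 + eigs T' := by
  have hmap : ∀ x ∈ Nᗮ, T x ∈ Nᗮ := fun x _ => by
    rw [Submodule.mem_orthogonal]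
    intro u hu
    rw [← hT, hN u hu, inner_zero_left]
  refine ⟨T.restrict hmap, hT.restrict_invariant hmap, fun x => rfl, ?_⟩
  let e := Submodule.prodEquivOfIsCompl N Nᗮ N.isCompl_orthogonal
  have hconj : e.symm.conj T = LinearMap.prodMap (0 : N →ₗ[ℝ] N) (T.restrict hmap) := by
    refine LinearMap.ext fun z => ?_
    rw [LinearEquiv.conj_apply_apply, LinearEquiv.symm_apply_eq]
    obtain ⟨x, y⟩ := z
    simp [e, hN]
  have h := e.symm.charpoly_conj T
  rw [hconj, LinearMap.charpoly_prodMap] at h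
  rw [eigs, eigs, ← h, Polynomial.roots_mul, LinearMap.charpoly_zero]
  · simp [Multiset.nsmul_singleton]
  · exact mul_ne_zero (LinearMap.charpoly_monic _).ne_zero (LinearMap.charpoly_monic _).ne_zero

end CourantFischer

/-! ### Factorizations of matrices of rank `r` -/

section RankFactorization

variable {p₁ p₂ r : ℕ}

theorem rank_eq_of_isUnit {Y : Matrix (Fin p₁) (Fin p₂) ℝ} (C : Matrix (Fin p₁) (Fin r) ℝ)
    (D : Matrix (Fin r) (Fin p₂) ℝ) (hY : Y = C * D) (A : Matrix (Fin r) (Fin p₁) ℝ)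
    (B : Matrix (Fin p₂) (Fin r) ℝ) (h : IsUnit (A * Y * B)) : Y.rank = r := by
  have h1 : (A * Y * B).rank = r := by simpa using rank_of_isUnit _ h
  have h2 : (A * Y * B).rank ≤ Y.rank := (rank_mul_le_left _ _).trans (rank_mul_le_right _ _)
  have h3 : Y.rank ≤ r := by
    rw [hY]
    exact (rank_mul_le_left _ _).trans (by simpa using rank_le_card_width C)
  omega

theorem isUnit_of_rank_eq {K : Matrix (Fin r) (Fin r) ℝ} (h : K.rank = r) : IsUnit K := by
  rw [← Matrix.mulVec_surjective_iff_isUnit]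
  have : LinearMap.range K.mulVecLin = ⊤ :=
    Submodule.eq_top_of_finrank_eq (by rw [← Matrix.rank, h]; simp)
  exact LinearMap.range_eq_top.mp this

/-- The Gram matrices `Lᵀ L` and `Rᵀ R` are invertible; this is the form in which full column rank
of the factors is used throughout. -/
theorem isUnit_gram_of_rank {L : Matrix (Fin p₁) (Fin r) ℝ} {R : Matrix (Fin p₂) (Fin r) ℝ}
    (h : (L * Rᵀ).rank = r) : IsUnit (Lᵀ * L) ∧ IsUnit (Rᵀ * R) := by
  have hL := rank_mul_le_left L Rᵀ
  have hR := rank_mul_le_right L Rᵀ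
  have hL' : L.rank ≤ r := by simpa using rank_le_card_width L
  have hR' : R.rank ≤ r := by simpa using rank_le_card_width R
  rw [rank_transpose] at hR
  constructor <;> refine isUnit_of_rank_eq ?_ <;> rw [rank_transpose_mul_self] <;> omega

/-- A matrix of rank `r` is recovered from `r` independent combinations of its columns and of its
rows. -/
theorem eq_mul_inv_mul_of_rank {Y : Matrix (Fin p₁) (Fin p₂) ℝ} (hY : Y.rank = r)
    (A : Matrix (Fin r) (Fin p₁) ℝ) (B : Matrix (Fin p₂) (Fin r) ℝ) (h : IsUnit (A * Y * B)) :
    Y = Y * B * (A * Y * B)⁻¹ * (A * Y) := by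
  have h1 : (A * Y * B).rank = r := by simpa using rank_of_isUnit _ h
  have h2 : (Y * B).rank = r := by
    refine le_antisymm ((rank_mul_le_left _ _).trans_eq hY) (h1.symm.trans_le ?_)
    rw [Matrix.mul_assoc]
    exact rank_mul_le_right _ _
  have hle : LinearMap.range (Y * B).mulVecLin ≤ LinearMap.range Y.mulVecLin := by
    rw [Matrix.mulVecLin_mul]
    exact LinearMap.range_comp_le_range _ _
  have heq := Submodule.eq_of_le_of_finrank_eq hle (h2.trans hY.symm)
  -- `Y B` has the same column space as `Y`, so `Y = Y B N` for some `N`.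
  have hN : ∀ j, ∃ v, (Y * B) *ᵥ v = Y.col j := by
    intro j
    have : Y.col j ∈ LinearMap.range (Y * B).mulVecLin := by
      rw [heq]
      exact ⟨Pi.single j 1, by simp⟩
    exact this
  choose N hN using hN
  have hYN : Y = Y * B * (of N)ᵀ := by
    ext i j
    have := congrFun (hN j) i
    simpa [Matrix.mul_apply, Matrix.mulVec, dotProduct] using this.symm
  have h3 : A * Y = A * Y * B * (of N)ᵀ := by
    conv_lhs => rw [hYN]
    simp only [Matrix.mul_assoc]
  have h4 : (A * Y * B)⁻¹ * (A * Y) = (of N)ᵀ := by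
    calc (A * Y * B)⁻¹ * (A * Y) = (A * Y * B)⁻¹ * (A * Y * B * (of N)ᵀ) := congrArg _ h3
      _ = (of N)ᵀ := by
        rw [← Matrix.mul_assoc, Matrix.nonsing_inv_mul _ ((isUnit_iff_isUnit_det _).mp h),
          Matrix.one_mul]
  rw [Matrix.mul_assoc (Y * B), h4]
  exact hYN

end RankFactorization

/-! ### The tangent space of the manifold of matrices of rank `r` -/

section TangentSpace

variable {p₁ p₂ r : ℕ}

/-- The differential `[A_L; A_R] ↦ L A_Rᵀ + A_L Rᵀ` of the factorization map `[L; R] ↦ L Rᵀ`. -/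
def facDeriv (L : Matrix (Fin p₁) (Fin r) ℝ) (R : Matrix (Fin p₂) (Fin r) ℝ) :
    Matrix (Fin p₁ ⊕ Fin p₂) (Fin r) ℝ →ₗ[ℝ] Matrix (Fin p₁) (Fin p₂) ℝ where
  toFun A := L * A.toRows₂ᵀ + A.toRows₁ * Rᵀ
  map_add' A B := by
    rw [show (A + B).toRows₁ = A.toRows₁ + B.toRows₁ from rfl,
      show (A + B).toRows₂ = A.toRows₂ + B.toRows₂ from rfl]
    simp only [Matrix.mul_add, Matrix.add_mul, Matrix.transpose_add]
    abel
  map_smul' c A := by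
    rw [show (c • A).toRows₁ = c • A.toRows₁ from rfl,
      show (c • A).toRows₂ = c • A.toRows₂ from rfl]
    simp

theorem facDeriv_apply (L : Matrix (Fin p₁) (Fin r) ℝ) (R : Matrix (Fin p₂) (Fin r) ℝ)
    (A : Matrix (Fin p₁ ⊕ Fin p₂) (Fin r) ℝ) :
    facDeriv L R A = L * A.toRows₂ᵀ + A.toRows₁ * Rᵀ := rfl

variable (L : Matrix (Fin p₁) (Fin r) ℝ) (R : Matrix (Fin p₂) (Fin r) ℝ)
  (A : Matrix (Fin p₁ ⊕ Fin p₂) (Fin r) ℝ)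

theorem hasDerivAt_facCurve (t : ℝ) :
    HasDerivAt (fun t : ℝ => (L + t • A.toRows₁) * (R + t • A.toRows₂)ᵀ)
      (facDeriv (L + t • A.toRows₁) (R + t • A.toRows₂) A) t := by
  rw [facDeriv_apply, add_comm]
  exact hasDerivAt_matMul (hasDerivAt_line L A.toRows₁ t)
    (hasDerivAt_transpose (hasDerivAt_line R A.toRows₂ t))

theorem contDiff_facCurve {k : ℕ∞ω} :
    ContDiff ℝ k (fun t : ℝ => (L + t • A.toRows₁) * (R + t • A.toRows₂)ᵀ) :=
  contDiff_matMul (contDiff_const.add (contDiff_id.smul contDiff_const))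
    (contDiff_transpose (contDiff_const.add (contDiff_id.smul contDiff_const)))

variable {L R}

theorem isUnit_mul_mul (hL : IsUnit (Lᵀ * L)) (hR : IsUnit (Rᵀ * R)) :
    IsUnit (Lᵀ * (L * Rᵀ) * R) := by
  simpa only [Matrix.mul_assoc] using hL.mul hR

theorem facCurve_eventually (hL : IsUnit (Lᵀ * L)) (hR : IsUnit (Rᵀ * R)) :
    ∀ᶠ t : ℝ in 𝓝 0, IsUnit ((L + t • A.toRows₁)ᵀ * (L + t • A.toRows₁)) ∧
      IsUnit ((R + t • A.toRows₂)ᵀ * (R + t • A.toRows₂)) ∧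
      (L + t • A.toRows₁) * (R + t • A.toRows₂)ᵀ ∈ rankManifold p₁ p₂ r := by
  have hc : ContDiff ℝ 0 fun t : ℝ => Lᵀ * ((L + t • A.toRows₁) * (R + t • A.toRows₂)ᵀ) * R :=
    contDiff_matMul (contDiff_matMul contDiff_const (contDiff_facCurve L R A)) contDiff_const
  filter_upwards [eventually_isUnit hc.continuous.continuousAt
    (by simpa using isUnit_mul_mul hL hR)] with t ht
  have hrank := rank_eq_of_isUnit _ _ rfl _ _ ht
  obtain ⟨h1, h2⟩ := isUnit_gram_of_rank hrank
  exact ⟨h1, h2, hrank⟩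

/-- The tangent space of the manifold of matrices of rank `r` at `L Rᵀ` consists of the matrices
`L A_Rᵀ + A_L Rᵀ`. -/
theorem tangentSpace_rankManifold (hL : IsUnit (Lᵀ * L)) (hR : IsUnit (Rᵀ * R)) :
    tangentSpace (rankManifold p₁ p₂ r) (L * Rᵀ) = LinearMap.range (facDeriv L R) := by
  apply le_antisymm
  · refine Submodule.span_le.mpr ?_
    rintro ξ ⟨γ, hγ, hγ0, hmem, hξ⟩
    -- Near `0` the curve factors smoothly as `(γ R (Lᵀ γ R)⁻¹) (Lᵀ γ)`.
    have hu0 : IsUnit (Lᵀ * γ 0 * R) := by rw [hγ0]; exact isUnit_mul_mul hL hR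
    have hd : DifferentiableAt ℝ γ 0 := hξ.differentiableAt
    have hdi : DifferentiableAt ℝ (fun t => Lᵀ * γ t * R) 0 :=
      differentiableAt_matMul (differentiableAt_matMul (differentiableAt_const _) hd)
        (differentiableAt_const _)
    have hdu : DifferentiableAt ℝ (fun t => γ t * R * (Lᵀ * γ t * R)⁻¹) 0 :=
      differentiableAt_matMul (differentiableAt_matMul hd (differentiableAt_const _))
        (differentiableAt_matInv hdi hu0)
    have hdw : HasDerivAt (fun t => Lᵀ * γ t) ((0 : Matrix _ _ ℝ) * γ 0 + Lᵀ * ξ) 0 :=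
      hasDerivAt_matMul (hasDerivAt_const _ Lᵀ) hξ
    have hprod := hasDerivAt_matMul hdu.hasDerivAt hdw
    have heq : γ =ᶠ[𝓝 0] fun t => γ t * R * (Lᵀ * γ t * R)⁻¹ * (Lᵀ * γ t) := by
      filter_upwards [hmem, eventually_isUnit hdi.continuousAt hu0] with t h1 h2
      exact eq_mul_inv_mul_of_rank h1 _ _ h2
    rw [hξ.unique (hprod.congr_of_eventuallyEq heq), hγ0]
    generalize deriv (fun t => γ t * R * (Lᵀ * γ t * R)⁻¹) 0 = u'
    refine ⟨fromRows (u' * (Lᵀ * L)) (((Rᵀ * R) * (Lᵀ * (L * Rᵀ) * R)⁻¹ *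
      ((0 : Matrix _ _ ℝ) * (L * Rᵀ) + Lᵀ * ξ))ᵀ), ?_⟩
    rw [facDeriv_apply, toRows₁_fromRows, toRows₂_fromRows, transpose_transpose]
    simp only [Matrix.mul_assoc]
    rw [add_comm]
  · rintro _ ⟨A, rfl⟩
    refine Submodule.subset_span ⟨_, contDiff_facCurve L R A, by simp,
      (facCurve_eventually A hL hR).mono fun t h => h.2.2, ?_⟩
    simpa using hasDerivAt_facCurve L R A 0

theorem facDeriv_mem_tangentSpace (hL : IsUnit (Lᵀ * L)) (hR : IsUnit (Rᵀ * R)) :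
    facDeriv L R A ∈ tangentSpace (rankManifold p₁ p₂ r) (L * Rᵀ) :=
  tangentSpace_rankManifold hL hR ▸ LinearMap.mem_range_self _ A

end TangentSpace

/-! ### The Riemannian gradient and Hessian -/

section RiemannianGradient

variable {E : Type*} [NormedAddCommGroup E] [InnerProductSpace ℝ E] [FiniteDimensional ℝ E]

theorem inner_riemGrad (M : Set E) (f : E → ℝ) (x : E) {z : E} (hz : z ∈ tangentSpace M x) :
    ⟪(riemGrad M f x : E), z⟫ = fderiv ℝ f x z := by
  have h := InnerProductSpace.toDual_symm_apply (𝕜 := ℝ) (x := (⟨z, hz⟩ : tangentSpace M x))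
    (y := (fderiv ℝ f x).comp (tangentSpace M x).subtypeL)
  exact h

theorem riemGrad_eq {M : Set E} {f : E → ℝ} {x v : E} (hv : v ∈ tangentSpace M x)
    (h : ∀ z ∈ tangentSpace M x, ⟪v, z⟫ = fderiv ℝ f x z) : (riemGrad M f x : E) = v := by
  have hd : (riemGrad M f x : E) - v ∈ tangentSpace M x := sub_mem (riemGrad M f x).2 hv
  have h0 : ⟪(riemGrad M f x : E) - v, (riemGrad M f x : E) - v⟫ = 0 := by
    rw [inner_sub_left, inner_riemGrad M f x hd, h _ hd, sub_self]
  exact sub_eq_zero.mp (inner_self_eq_zero.mp h0)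

theorem inner_riemHess (M : Set E) (f : E → ℝ) (x : E) (ξ η : tangentSpace M x) :
    ⟪riemHess M f x ξ, η⟫ = ⟪fderivWithin ℝ (fun y => (riemGrad M f y : E)) M x ξ, (η : E)⟫ := by
  simp only [riemHess, ContinuousLinearMap.coe_coe, ContinuousLinearMap.comp_apply,
    Submodule.subtypeL_apply]
  exact Submodule.inner_orthogonalProjectionOnto_eq_of_mem_right η _

end RiemannianGradient

/-! ### Smoothness of the Riemannian gradient on the manifold of rank `r` -/

section RiemannianGradientRank

variable {p₁ p₂ r : ℕ}

/-- The orthogonal projection `a (aᵀ a)⁻¹ aᵀ` onto the column space of a matrix `a` of full column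
rank. -/
noncomputable def colProj {p : ℕ} (a : Matrix (Fin p) (Fin r) ℝ) : Matrix (Fin p) (Fin p) ℝ :=
  a * (aᵀ * a)⁻¹ * aᵀ

theorem colProj_transpose {p : ℕ} (a : Matrix (Fin p) (Fin r) ℝ) : (colProj a)ᵀ = colProj a := by
  simp [colProj, Matrix.transpose_nonsing_inv, Matrix.mul_assoc]

theorem colProj_mul {p : ℕ} {a : Matrix (Fin p) (Fin r) ℝ} (ha : IsUnit (aᵀ * a)) :
    colProj a * a = a := by
  rw [colProj, Matrix.mul_assoc, Matrix.mul_assoc,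
    Matrix.nonsing_inv_mul _ ((isUnit_iff_isUnit_det _).mp ha), Matrix.mul_one]

theorem transpose_mul_colProj {p : ℕ} {a : Matrix (Fin p) (Fin r) ℝ} (ha : IsUnit (aᵀ * a)) :
    aᵀ * colProj a = aᵀ := by
  rw [← colProj_transpose, ← transpose_mul, colProj_mul ha]

/-- The Riemannian gradient is the projection `G ↦ P_a G + G P_b - P_a G P_b` of the Euclidean
gradient `G` to the tangent space. -/
theorem riemGrad_rankManifold (f : Matrix (Fin p₁) (Fin p₂) ℝ → ℝ)
    {a : Matrix (Fin p₁) (Fin r) ℝ} {b : Matrix (Fin p₂) (Fin r) ℝ}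
    (ha : IsUnit (aᵀ * a)) (hb : IsUnit (bᵀ * b)) :
    (riemGrad (rankManifold p₁ p₂ r) f (a * bᵀ) : Matrix (Fin p₁) (Fin p₂) ℝ) =
      colProj a * gradient f (a * bᵀ) + gradient f (a * bᵀ) * colProj b -
        colProj a * gradient f (a * bᵀ) * colProj b := by
  generalize hG : gradient f (a * bᵀ) = G
  apply riemGrad_eq <;> rw [tangentSpace_rankManifold ha hb]
  · refine ⟨fromRows ((G - colProj a * G) * b * (bᵀ * b)⁻¹) (((aᵀ * a)⁻¹ * aᵀ * G)ᵀ), ?_⟩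
    simp only [facDeriv_apply, toRows₁_fromRows, toRows₂_fromRows, transpose_transpose, colProj,
      Matrix.sub_mul, Matrix.mul_assoc]
    abel
  · rintro _ ⟨A, rfl⟩
    rw [← inner_gradient_eq_fderiv, hG]
    have hz : colProj a * facDeriv a b A + facDeriv a b A * colProj b -
        colProj a * facDeriv a b A * colProj b = facDeriv a b A := by
      rw [facDeriv_apply]
      simp only [Matrix.mul_add, Matrix.add_mul]
      rw [← Matrix.mul_assoc (colProj a) a, colProj_mul ha, Matrix.mul_assoc A.toRows₁,
        transpose_mul_colProj hb, Matrix.mul_assoc (colProj a) (A.toRows₁ * bᵀ),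
        Matrix.mul_assoc A.toRows₁, transpose_mul_colProj hb]
      abel
    conv_rhs => rw [← hz]
    simp only [inner_add_left, inner_sub_left, inner_add_right, inner_sub_right]
    rw [inner_mul_right_eq (colProj a * G), inner_mul_right_eq G, inner_mul_left_eq,
      inner_mul_left_eq (colProj a) G (_ * _), colProj_transpose, colProj_transpose,
      Matrix.mul_assoc]

theorem differentiableAt_colProj {p : ℕ} {E : Type*} [NormedAddCommGroup E] [NormedSpace ℝ E]
    {x : E} {a : E → Matrix (Fin p) (Fin r) ℝ} (ha : DifferentiableAt ℝ a x)
    (hu : IsUnit ((a x)ᵀ * a x)) : DifferentiableAt ℝ (fun y => colProj (a y)) x :=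
  differentiableAt_matMul (differentiableAt_matMul ha
    (differentiableAt_matInv (differentiableAt_matMul (differentiableAt_transpose ha) ha) hu))
    (differentiableAt_transpose ha)

theorem differentiable_gradient {E : Type*} [NormedAddCommGroup E] [InnerProductSpace ℝ E]
    [CompleteSpace E] {g : E → ℝ} (hg : ContDiff ℝ 2 g) : Differentiable ℝ (gradient g) :=
  fun x => (InnerProductSpace.toDual ℝ E).symm.differentiableAt.comp x
    ((hg.fderiv_right (m := 1) (by norm_num)).differentiable (by norm_num) x)

/-- Only differentiability within the manifold is meaningful: off the manifold `riemGrad` refers to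
the tangent space of a set that does not contain the point. -/
theorem differentiableWithinAt_riemGrad {f : Matrix (Fin p₁) (Fin p₂) ℝ → ℝ}
    (hf : ContDiff ℝ 2 f) {L : Matrix (Fin p₁) (Fin r) ℝ} {R : Matrix (Fin p₂) (Fin r) ℝ}
    (hL : IsUnit (Lᵀ * L)) (hR : IsUnit (Rᵀ * R)) :
    DifferentiableWithinAt ℝ
      (fun Y => (riemGrad (rankManifold p₁ p₂ r) f Y : Matrix (Fin p₁) (Fin p₂) ℝ))
      (rankManifold p₁ p₂ r) (L * Rᵀ) := by
  -- Near `L Rᵀ` every `Y` in the manifold is `a bᵀ`, where `a` and `b` depend smoothly on `Y`.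
  let a : Matrix (Fin p₁) (Fin p₂) ℝ → Matrix (Fin p₁) (Fin r) ℝ :=
    fun Y => Y * R * (Lᵀ * Y * R)⁻¹
  let b : Matrix (Fin p₁) (Fin p₂) ℝ → Matrix (Fin p₂) (Fin r) ℝ := fun Y => (Lᵀ * Y)ᵀ
  have hu := isUnit_mul_mul hL hR
  have hrank := rank_eq_of_isUnit L Rᵀ rfl _ _ hu
  have hfac : ∀ Y : Matrix (Fin p₁) (Fin p₂) ℝ, Y.rank = r → IsUnit (Lᵀ * Y * R) →
      Y = a Y * (b Y)ᵀ ∧ IsUnit ((a Y)ᵀ * a Y) ∧ IsUnit ((b Y)ᵀ * b Y) := by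
    intro Y hY hYu
    have h : Y = a Y * (b Y)ᵀ := by
      simpa only [a, b, transpose_transpose] using eq_mul_inv_mul_of_rank hY _ _ hYu
    refine ⟨h, isUnit_gram_of_rank ?_⟩
    rw [← h, hY]
  have hid : DifferentiableAt ℝ (fun Y : Matrix (Fin p₁) (Fin p₂) ℝ => Y) (L * Rᵀ) :=
    differentiableAt_id
  have hmid : DifferentiableAt ℝ (fun Y : Matrix (Fin p₁) (Fin p₂) ℝ => Lᵀ * Y * R) (L * Rᵀ) :=
    differentiableAt_matMul (differentiableAt_matMul (differentiableAt_const _) hid)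
      (differentiableAt_const _)
  have ha : DifferentiableAt ℝ a (L * Rᵀ) :=
    differentiableAt_matMul (differentiableAt_matMul hid (differentiableAt_const _))
      (differentiableAt_matInv hmid hu)
  have hb : DifferentiableAt ℝ b (L * Rᵀ) :=
    differentiableAt_transpose (differentiableAt_matMul (differentiableAt_const _) hid)
  obtain ⟨h0, h1, h2⟩ := hfac _ hrank hu
  have hPa := differentiableAt_colProj ha h1
  have hPb := differentiableAt_colProj hb h2
  have hG := differentiable_gradient hf (L * Rᵀ)
  have hF := ((differentiableAt_matMul hPa hG).add (differentiableAt_matMul hG hPb)).sub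
    (differentiableAt_matMul (differentiableAt_matMul hPa hG) hPb)
  refine hF.differentiableWithinAt.congr_of_eventuallyEq_of_mem ?_ hrank
  filter_upwards [self_mem_nhdsWithin,
    mem_nhdsWithin_of_mem_nhds (eventually_isUnit hmid.continuousAt hu)] with Y hY hYu
  obtain ⟨hY0, hY1, hY2⟩ := hfac Y hY hYu
  have := riemGrad_rankManifold f hY1 hY2
  rw [← hY0] at this
  exact this

end RiemannianGradientRank

/-! ### The factorized and the regularized function -/

section Factorization

variable {p₁ p₂ r : ℕ} {f : Matrix (Fin p₁) (Fin p₂) ℝ → ℝ}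
  (L : Matrix (Fin p₁) (Fin r) ℝ) (R : Matrix (Fin p₂) (Fin r) ℝ)

theorem fromRows_add_smul (A : Matrix (Fin p₁ ⊕ Fin p₂) (Fin r) ℝ) (t : ℝ) :
    fromRows L R + t • A = fromRows (L + t • A.toRows₁) (R + t • A.toRows₂) := by
  ext (i | i) j <;> rfl

theorem contDiff_gFac (hf : ContDiff ℝ 2 f) :
    ContDiff ℝ 2 (gFac f : Matrix (Fin p₁ ⊕ Fin p₂) (Fin r) ℝ → ℝ) :=
  hf.comp (contDiff_matMul contDiff_toRows₁ (contDiff_transpose contDiff_toRows₂))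

/-- The imbalance `Lᵀ L - Rᵀ R` of a stacked matrix `[L; R]`. -/
def imbalance (W : Matrix (Fin p₁ ⊕ Fin p₂) (Fin r) ℝ) : Matrix (Fin r) (Fin r) ℝ :=
  W.toRows₁ᵀ * W.toRows₁ - W.toRows₂ᵀ * W.toRows₂

theorem contDiff_imbalance {k : ℕ∞ω} :
    ContDiff ℝ k (imbalance : Matrix (Fin p₁ ⊕ Fin p₂) (Fin r) ℝ → _) :=
  (contDiff_matMul (contDiff_transpose contDiff_toRows₁) contDiff_toRows₁).sub
    (contDiff_matMul (contDiff_transpose contDiff_toRows₂) contDiff_toRows₂)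

theorem contDiff_gReg (hf : ContDiff ℝ 2 f) (μ : ℝ) :
    ContDiff ℝ 2 (gReg f μ : Matrix (Fin p₁ ⊕ Fin p₂) (Fin r) ℝ → ℝ) :=
  (contDiff_gFac hf).add (contDiff_const.mul (contDiff_imbalance.norm_sq ℝ))

theorem hasDerivAt_comp_line {V : Type*} [NormedAddCommGroup V] [NormedSpace ℝ V] {g : V → ℝ}
    {x : V} (hg : DifferentiableAt ℝ g x) (v : V) :
    HasDerivAt (fun t : ℝ => g (x + t • v)) (fderiv ℝ g x v) 0 := by
  have h : HasFDerivAt g (fderiv ℝ g x) (x + (0 : ℝ) • v) := by simpa using hg.hasFDerivAt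
  exact h.comp_hasDerivAt (0 : ℝ) (hasDerivAt_line x v 0)

theorem fderiv_gFac (hf : ContDiff ℝ 2 f) (B : Matrix (Fin p₁ ⊕ Fin p₂) (Fin r) ℝ) :
    fderiv ℝ (gFac f) (fromRows L R) B = fderiv ℝ f (L * Rᵀ) (facDeriv L R B) := by
  have h1 := hasDerivAt_comp_line
    ((contDiff_gFac (r := r) hf).differentiable (by norm_num) (fromRows L R)) B
  have h2 := hasDerivAt_facCurve L R B 0
  have h3 : HasFDerivAt f (fderiv ℝ f (L * Rᵀ))
      ((L + (0 : ℝ) • B.toRows₁) * (R + (0 : ℝ) • B.toRows₂)ᵀ) := by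
    simpa using (hf.differentiable (by norm_num) (L * Rᵀ)).hasFDerivAt
  have h4 := h3.comp_hasDerivAt (0 : ℝ) h2
  simp only [fromRows_add_smul, gFac, toRows₁_fromRows, toRows₂_fromRows] at h1
  simpa using h1.unique h4

theorem hasDerivAt_imbalance (A : Matrix (Fin p₁ ⊕ Fin p₂) (Fin r) ℝ) :
    HasDerivAt (fun t : ℝ => imbalance (fromRows L R + t • A)) (balance L R A) 0 := by
  simp only [fromRows_add_smul, imbalance, toRows₁_fromRows, toRows₂_fromRows]
  have h1 := hasDerivAt_line L A.toRows₁ 0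
  have h2 := hasDerivAt_line R A.toRows₂ 0
  convert! (hasDerivAt_matMul (hasDerivAt_transpose h1) h1).sub
    (hasDerivAt_matMul (hasDerivAt_transpose h2) h2) using 1
  simp only [balance, zero_smul, add_zero]
  abel

theorem fderiv_gReg (hf : ContDiff ℝ 2 f) (μ : ℝ) (B : Matrix (Fin p₁ ⊕ Fin p₂) (Fin r) ℝ) :
    fderiv ℝ (gReg f μ) (fromRows L R) B =
      fderiv ℝ (gFac f) (fromRows L R) B +
        μ * ⟪imbalance (fromRows L R), balance L R B⟫ := by
  have h1 := hasDerivAt_comp_line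
    ((contDiff_gReg (r := r) hf μ).differentiable (by norm_num) (fromRows L R)) B
  have h2 := hasDerivAt_comp_line
    ((contDiff_gFac (r := r) hf).differentiable (by norm_num) (fromRows L R)) B
  have h3 := h2.add ((hasDerivAt_imbalance L R B).norm_sq.const_mul (μ / 2))
  have h4 := h1.unique h3
  rw [h4]
  simp only [zero_smul, add_zero]
  ring

theorem balance_add_smul (A B : Matrix (Fin p₁ ⊕ Fin p₂) (Fin r) ℝ) (t : ℝ) :
    balance (L + t • A.toRows₁) (R + t • A.toRows₂) B =
      balance L R B + t • balance A.toRows₁ A.toRows₂ B := by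
  simp only [balance, Matrix.add_mul, Matrix.mul_add, transpose_add, transpose_smul,
    Matrix.smul_mul, Matrix.mul_smul, smul_sub, smul_add]
  abel

/-- At a balanced point the regularizer adds `μ ⟪b(A), b(B)⟫` to the Hessian form. -/
theorem inner_euclHess_gReg (hf : ContDiff ℝ 2 f) (μ : ℝ) (hbal : Lᵀ * L = Rᵀ * R)
    (A B : Matrix (Fin p₁ ⊕ Fin p₂) (Fin r) ℝ) :
    ⟪euclHess (gReg f μ) (fromRows L R) A, B⟫ =
      ⟪euclHess (gFac f) (fromRows L R) A, B⟫ + μ * ⟪balance L R A, balance L R B⟫ := by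
  have h1 := hasDerivAt_fderiv_line (contDiff_gReg (r := r) hf μ) (fromRows L R) A B
  have h2 := hasDerivAt_fderiv_line (contDiff_gFac (r := r) hf) (fromRows L R) A B
  have h3 := (hasDerivAt_imbalance L R A).inner ℝ
    (hasDerivAt_line (balance L R B) (balance A.toRows₁ A.toRows₂ B) 0)
  have h4 := h2.add (h3.const_mul μ)
  have h0 : imbalance (fromRows L R) = 0 := by simp [imbalance, hbal]
  have heq : (fun t : ℝ => fderiv ℝ (gReg f μ) (fromRows L R + t • A) B) = fun t =>
      fderiv ℝ (gFac f) (fromRows L R + t • A) B +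
        μ * ⟪imbalance (fromRows L R + t • A),
          balance L R B + t • balance A.toRows₁ A.toRows₂ B⟫ := by
    funext t
    rw [← balance_add_smul, fromRows_add_smul, fderiv_gReg _ _ hf]
  rw [heq] at h1
  rw [h1.unique h4]
  simp [h0]

variable {L R}

/-- At a critical point of the regularized function, the derivative in the direction
`[L Δ; -R Δ]`, `Δ = Lᵀ L - Rᵀ R`, which does not change `L Rᵀ` to first order, shows `Δ = 0`. -/
theorem balanced_of_gradient_eq_zero (hf : ContDiff ℝ 2 f) {μ : ℝ} (hμ : 0 < μ)
    (h : gradient (gReg f μ) (fromRows L R) = 0) : Lᵀ * L = Rᵀ * R := by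
  have h0 : ∀ B, fderiv ℝ (gReg f μ) (fromRows L R) B = 0 := fun B => by
    rw [← inner_gradient_eq_fderiv, h, inner_zero_left]
  obtain ⟨D, hD⟩ : ∃ D, D = Lᵀ * L - Rᵀ * R := ⟨_, rfl⟩
  have hDt : Dᵀ = D := by simp [hD]
  have h1 := h0 (fromRows (L * D) (-(R * D)))
  have h2 : facDeriv L R (fromRows (L * D) (-(R * D))) = 0 := by
    simp [facDeriv_apply, hDt, Matrix.mul_assoc]
  have h3 : balance L R (fromRows (L * D) (-(R * D))) =
      ((Lᵀ * L) * D + (Rᵀ * R) * D) + (D * (Lᵀ * L) + D * (Rᵀ * R)) := by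
    simp only [balance, toRows₁_fromRows, toRows₂_fromRows, transpose_mul, transpose_neg, hDt,
      Matrix.mul_neg, Matrix.neg_mul, Matrix.mul_assoc]
    abel
  rw [fderiv_gReg _ _ hf, fderiv_gFac _ _ hf, h2, h3, map_zero, zero_add] at h1
  have h4 : imbalance (fromRows L R) = D := by simp [imbalance, hD]
  have h5 : ⟪D, ((Lᵀ * L) * D + (Rᵀ * R) * D) + (D * (Lᵀ * L) + D * (Rᵀ * R))⟫ =
      2 * (‖L * D‖ ^ 2 + ‖R * D‖ ^ 2) := by
    have e1 : ∀ {p : ℕ} (Q : Matrix (Fin p) (Fin r) ℝ), ⟪D, (Qᵀ * Q) * D⟫ = ‖Q * D‖ ^ 2 := by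
      intro p Q
      rw [Matrix.mul_assoc, ← inner_mul_left_eq, real_inner_self_eq_norm_sq]
    have e2 : ∀ {p : ℕ} (Q : Matrix (Fin p) (Fin r) ℝ), ⟪D, D * (Qᵀ * Q)⟫ = ‖Q * D‖ ^ 2 := by
      intro p Q
      rw [← inner_transpose_transpose]
      simp only [transpose_mul, transpose_transpose, hDt]
      exact e1 Q
    rw [inner_add_right, inner_add_right, inner_add_right, e1, e1, e2, e2]
    ring
  rw [h4, h5] at h1
  have h6 : ‖L * D‖ ^ 2 + ‖R * D‖ ^ 2 = 0 := by
    have := mul_eq_zero.mp h1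
    rcases this with h | h <;> linarith
  have hLD : L * D = 0 := by
    have : ‖L * D‖ ^ 2 = 0 := by nlinarith [sq_nonneg ‖L * D‖, sq_nonneg ‖R * D‖]
    simpa using this
  have hRD : R * D = 0 := by
    have : ‖R * D‖ ^ 2 = 0 := by nlinarith [sq_nonneg ‖L * D‖, sq_nonneg ‖R * D‖]
    simpa using this
  -- `L Δ = 0` and `R Δ = 0` give `Δ² = 0` by the definition of `Δ`.
  have hDD : Dᵀ * D = 0 := by
    rw [hDt]
    nth_rw 1 [hD]
    rw [Matrix.sub_mul, Matrix.mul_assoc, Matrix.mul_assoc, hLD, hRD]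
    simp
  have hD0 : D = 0 := by
    have : ⟪D, D⟫ = 0 := by rw [inner_eq_trace, hDD, Matrix.trace_zero]
    exact inner_self_eq_zero.mp this
  exact sub_eq_zero.mp (hD ▸ hD0)

theorem gradient_gReg_eq (hf : ContDiff ℝ 2 f) (μ : ℝ) (hbal : Lᵀ * L = Rᵀ * R) :
    gradient (gReg f μ) (fromRows L R) = gradient (gFac f) (fromRows L R) := by
  refine ext_inner_right ℝ fun B => ?_
  rw [inner_gradient_eq_fderiv, inner_gradient_eq_fderiv, fderiv_gReg _ _ hf]
  simp [imbalance, hbal]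

/-- At a critical point `[L; R]` of the factorized function, the Riemannian Hessian of `f` and the
Euclidean Hessian of the factorized function are the same form. With `F` the Riemannian gradient,
both sides are the derivative at `t = 0` of `⟪F(γ(t)), Z(t)⟫ = D g(W + t A)[B]`, where `γ(t)` is the
product of the blocks of `W + t A` and `Z(t)` its derivative in direction `B`; the derivative of `Z`
does not contribute, since `F` vanishes at `t = 0`. -/
theorem inner_riemHess_facDeriv (hf : ContDiff ℝ 2 f) (hL : IsUnit (Lᵀ * L))
    (hR : IsUnit (Rᵀ * R)) (h : gradient (gFac f) (fromRows L R) = 0)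
    (A B : Matrix (Fin p₁ ⊕ Fin p₂) (Fin r) ℝ) :
    ⟪riemHess (rankManifold p₁ p₂ r) f (L * Rᵀ) ⟨_, facDeriv_mem_tangentSpace A hL hR⟩,
      ⟨_, facDeriv_mem_tangentSpace B hL hR⟩⟫ =
      ⟪euclHess (gFac f) (fromRows L R) A, B⟫ := by
  set M := rankManifold p₁ p₂ r
  rw [inner_riemHess]
  let F : Matrix (Fin p₁) (Fin p₂) ℝ → Matrix (Fin p₁) (Fin p₂) ℝ := fun Y => riemGrad M f Y
  let γ : ℝ → Matrix (Fin p₁) (Fin p₂) ℝ :=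
    fun t => (L + t • A.toRows₁) * (R + t • A.toRows₂)ᵀ
  let Z : ℝ → Matrix (Fin p₁) (Fin p₂) ℝ :=
    fun t => facDeriv (L + t • A.toRows₁) (R + t • A.toRows₂) B
  have hγ0 : γ 0 = L * Rᵀ := by simp [γ]
  have hev := facCurve_eventually A hL hR
  have hγ : HasDerivAt γ (facDeriv L R A) 0 := by
    simpa only [zero_smul, add_zero] using hasDerivAt_facCurve L R A 0
  have hF0 : F (γ 0) = 0 := by
    rw [hγ0]
    refine riemGrad_eq (zero_mem _) fun z hz => ?_
    rw [tangentSpace_rankManifold hL hR] at hz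
    obtain ⟨C, rfl⟩ := hz
    rw [← fderiv_gFac L R hf, ← inner_gradient_eq_fderiv, h, inner_zero_left, inner_zero_left]
  have hFγ : HasDerivAt (fun t => F (γ t)) (fderivWithin ℝ F M (L * Rᵀ) (facDeriv L R A)) 0 := by
    have hd : HasFDerivWithinAt F (fderivWithin ℝ F M (L * Rᵀ)) M (γ 0) := by
      rw [hγ0]
      exact (differentiableWithinAt_riemGrad hf hL hR).hasFDerivWithinAt
    have hS : γ ⁻¹' M ∈ 𝓝 (0 : ℝ) := hev.mono fun t ht => ht.2.2
    exact (hd.comp_hasDerivWithinAt (0 : ℝ) (s := γ ⁻¹' M) hγ.hasDerivWithinAt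
      (fun t ht => ht)).hasDerivAt hS
  obtain ⟨Z', hZ⟩ : ∃ Z', HasDerivAt Z Z' 0 := by
    have h1 := hasDerivAt_matMul (hasDerivAt_line L A.toRows₁ 0)
      (hasDerivAt_const (0 : ℝ) B.toRows₂ᵀ)
    have h2 := hasDerivAt_matMul (hasDerivAt_const (0 : ℝ) B.toRows₁)
      (hasDerivAt_transpose (hasDerivAt_line R A.toRows₂ 0))
    exact ⟨_, h1.add h2⟩
  have h1 := hFγ.inner ℝ hZ
  have h2 := hasDerivAt_fderiv_line (contDiff_gFac (r := r) hf) (fromRows L R) A B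
  have heq : (fun t : ℝ => fderiv ℝ (gFac f) (fromRows L R + t • A) B) =ᶠ[𝓝 0]
      fun t => ⟪F (γ t), Z t⟫ := by
    filter_upwards [hev] with t ht
    rw [fromRows_add_smul, fderiv_gFac _ _ hf]
    exact (inner_riemGrad _ _ _ (facDeriv_mem_tangentSpace B ht.1 ht.2.1)).symm
  have h3 := h2.unique (h1.congr_of_eventuallyEq heq)
  rw [h3, hF0, inner_zero_left, zero_add]
  simp only [Z, F, zero_smul, add_zero]
  rfl

end Factorization

/-! ### Skew-symmetric matrices -/

section SkewMatrices

/-- The space of skew-symmetric matrices. -/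
def skewMat (r : ℕ) : Submodule ℝ (Matrix (Fin r) (Fin r) ℝ) where
  carrier := {M | Mᵀ = -M}
  zero_mem' := by simp
  add_mem' {A B} hA hB := by
    simp only [Set.mem_ofPred_eq, transpose_add] at *
    rw [hA, hB]
    abel
  smul_mem' c A hA := by
    simp only [Set.mem_ofPred_eq, transpose_smul] at *
    rw [hA, smul_neg]

theorem mem_skewMat {r : ℕ} {M : Matrix (Fin r) (Fin r) ℝ} : M ∈ skewMat r ↔ Mᵀ = -M := Iff.rfl

/-- A skew-symmetric matrix is determined by its entries below the diagonal, which are arbitrary. -/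
def skewMatEquiv (r : ℕ) : skewMat r ≃ₗ[ℝ] ({p : Fin r × Fin r // p.2 < p.1} → ℝ) where
  toFun M p := M.1 p.1.1 p.1.2
  map_add' _ _ := rfl
  map_smul' _ _ := rfl
  invFun c := ⟨of fun i j => if h : j < i then c ⟨(i, j), h⟩ else
      if h : i < j then -c ⟨(j, i), h⟩ else 0, by
    rw [mem_skewMat]
    ext i j
    simp only [transpose_apply, of_apply]
    rcases lt_trichotomy i j with h | rfl | h
    · simp [h, h.not_gt]
    · simp
    · simp [h, h.not_gt]⟩
  left_inv := by
    rintro ⟨M, hM⟩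
    rw [mem_skewMat] at hM
    ext i j
    have hij : M j i = -M i j := congrFun (congrFun hM i) j
    rcases lt_trichotomy i j with h | rfl | h
    · simp [h, h.not_gt, hij]
    · simp only [of_apply, lt_self_iff_false, dite_false]
      linarith
    · simp [h]
  right_inv c := by
    ext ⟨⟨i, j⟩, h⟩
    have h' : j < i := h
    simp [h']

theorem finrank_skewMat (r : ℕ) : finrank ℝ (skewMat r) = (r ^ 2 - r) / 2 := by
  rw [(skewMatEquiv r).finrank_eq, finrank_fintype_fun_eq_card, Fintype.card_subtype,
    Finset.card_filter, Fintype.sum_prod_type]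
  have : ∀ i : Fin r, ∑ j : Fin r, (if j < i then 1 else 0) = (i : ℕ) := fun i => by
    rw [← Finset.card_filter, ← Fin.card_Iio i]
    congr 1
    ext j
    simp
  simp only [this]
  rw [Fin.sum_univ_eq_sum_range (fun i => i) r, Finset.sum_range_id, sq, Nat.mul_sub, mul_one]

end SkewMatrices

/-! ### The kernel of the differential of the factorization -/

section Kernel

variable {p₁ p₂ r : ℕ} {L : Matrix (Fin p₁) (Fin r) ℝ} {R : Matrix (Fin p₂) (Fin r) ℝ}

theorem eq_zero_of_isUnit_gram {p : ℕ} {Q : Matrix (Fin p) (Fin r) ℝ} (hQ : IsUnit (Qᵀ * Q))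
    {n : Type*} {B : Matrix (Fin r) n ℝ} (h : Q * B = 0) : B = 0 := by
  have h1 : (Qᵀ * Q)⁻¹ * ((Qᵀ * Q) * B) = B := by
    rw [← Matrix.mul_assoc, nonsing_inv_mul _ ((isUnit_iff_isUnit_det _).mp hQ), Matrix.one_mul]
  rw [← h1, Matrix.mul_assoc Qᵀ, h]
  simp

variable (L R) in
/-- The map `N ↦ [L N; -R Nᵀ]`, which parametrizes the kernel of `facDeriv L R`. -/
def kerMap : Matrix (Fin r) (Fin r) ℝ →ₗ[ℝ] Matrix (Fin p₁ ⊕ Fin p₂) (Fin r) ℝ where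
  toFun N := fromRows (L * N) (-(R * Nᵀ))
  map_add' A B := by
    ext (i | i) j <;> simp [Matrix.mul_add]
    ring
  map_smul' c A := by ext (i | i) j <;> simp

theorem kerMap_apply (N : Matrix (Fin r) (Fin r) ℝ) :
    kerMap L R N = fromRows (L * N) (-(R * Nᵀ)) := rfl

theorem kerMap_injective (hL : IsUnit (Lᵀ * L)) : Function.Injective (kerMap L R) := by
  rw [injective_iff_map_eq_zero]
  intro N hN
  exact eq_zero_of_isUnit_gram hL (congrArg toRows₁ hN)

theorem ker_facDeriv (hL : IsUnit (Lᵀ * L)) (hR : IsUnit (Rᵀ * R)) :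
    LinearMap.ker (facDeriv L R) = LinearMap.range (kerMap L R) := by
  ext A
  rw [LinearMap.mem_ker, LinearMap.mem_range]
  constructor
  · intro hA
    rw [facDeriv_apply] at hA
    have hRd := (isUnit_iff_isUnit_det _).mp hR
    obtain ⟨N, hN⟩ : ∃ N, N = -(A.toRows₂ᵀ * R * (Rᵀ * R)⁻¹) := ⟨_, rfl⟩
    have h1 : A.toRows₁ = L * N := by
      have h2 : A.toRows₁ * Rᵀ * R = -(L * A.toRows₂ᵀ * R) := by
        rw [eq_neg_iff_add_eq_zero, add_comm, ← Matrix.add_mul, hA, Matrix.zero_mul]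
      calc A.toRows₁ = A.toRows₁ * (Rᵀ * R) * (Rᵀ * R)⁻¹ := by
            rw [Matrix.mul_assoc, mul_nonsing_inv _ hRd, Matrix.mul_one]
        _ = L * N := by
            rw [← Matrix.mul_assoc, h2, hN]
            simp only [Matrix.mul_assoc, Matrix.neg_mul, Matrix.mul_neg]
    have h3 : A.toRows₂ᵀ = -(N * Rᵀ) := by
      rw [h1, Matrix.mul_assoc, ← Matrix.mul_add] at hA
      exact eq_neg_of_add_eq_zero_left (eq_zero_of_isUnit_gram hL hA)
    have h4 : A.toRows₂ = -(R * Nᵀ) := by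
      rw [← transpose_transpose A.toRows₂, h3]
      simp
    exact ⟨N, by rw [kerMap_apply, ← h1, ← h4, fromRows_toRows]⟩
  · rintro ⟨N, rfl⟩
    simp [facDeriv_apply, kerMap_apply, Matrix.mul_assoc]

theorem finrank_ker_facDeriv (hL : IsUnit (Lᵀ * L)) (hR : IsUnit (Rᵀ * R)) :
    finrank ℝ (LinearMap.ker (facDeriv L R)) = r * r := by
  rw [ker_facDeriv hL hR, LinearMap.finrank_range_of_inj (kerMap_injective hL)]
  simp [finrank_matrix]

theorem finrank_range_facDeriv (hL : IsUnit (Lᵀ * L)) (hR : IsUnit (Rᵀ * R)) :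
    finrank ℝ (LinearMap.range (facDeriv L R)) + r * r = (p₁ + p₂) * r := by
  rw [← finrank_ker_facDeriv hL hR, LinearMap.finrank_range_add_finrank_ker]
  simp [finrank_matrix]

/-- The condition is the vanishing of the adjoint of `kerMap L R` at `A`. -/
theorem mem_ker_facDeriv_orthogonal (hL : IsUnit (Lᵀ * L)) (hR : IsUnit (Rᵀ * R))
    {A : Matrix (Fin p₁ ⊕ Fin p₂) (Fin r) ℝ} :
    A ∈ (LinearMap.ker (facDeriv L R))ᗮ ↔ Lᵀ * A.toRows₁ = A.toRows₂ᵀ * R := by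
  have key : ∀ N, ⟪kerMap L R N, A⟫ = ⟪N, Lᵀ * A.toRows₁ - A.toRows₂ᵀ * R⟫ := by
    intro N
    rw [inner_eq_toRows, kerMap_apply, toRows₁_fromRows, toRows₂_fromRows, inner_neg_left,
      inner_mul_left_eq, inner_mul_left_eq, inner_sub_right, ← inner_transpose_transpose Nᵀ]
    simp only [transpose_mul, transpose_transpose]
    ring
  rw [Submodule.mem_orthogonal, ker_facDeriv hL hR, ← sub_eq_zero]
  constructor
  · intro h
    have := h _ (LinearMap.mem_range_self (kerMap L R) (Lᵀ * A.toRows₁ - A.toRows₂ᵀ * R))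
    rw [key] at this
    exact inner_self_eq_zero.mp this
  · rintro h _ ⟨N, rfl⟩
    rw [key, h, inner_zero_right]

/-- Since `b` vanishes on `(ker τ)ᗮ`, the regularizer is invisible in horizontal directions. -/
theorem balance_eq_zero_of_mem_orthogonal (hL : IsUnit (Lᵀ * L)) (hR : IsUnit (Rᵀ * R))
    {A : Matrix (Fin p₁ ⊕ Fin p₂) (Fin r) ℝ} (hA : A ∈ (LinearMap.ker (facDeriv L R))ᗮ) :
    balance L R A = 0 := by
  rw [mem_ker_facDeriv_orthogonal hL hR] at hA
  have h2 : A.toRows₁ᵀ * L = Rᵀ * A.toRows₂ := by simpa using congrArg transpose hA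
  rw [balance, hA, h2]
  abel

variable (L R) in
/-- The directions `[L M; R M]`, `M` skew-symmetric, tangent to the orbit of `[L; R]` under
`[L; R] ↦ [L Q; R Q]`, `Q` orthogonal. -/
def orbitSpace : Submodule ℝ (Matrix (Fin p₁ ⊕ Fin p₂) (Fin r) ℝ) :=
  (skewMat r).map (kerMap L R)

theorem finrank_orbitSpace (hL : IsUnit (Lᵀ * L)) :
    finrank ℝ (orbitSpace L R) = (r ^ 2 - r) / 2 := by
  rw [← finrank_skewMat]
  exact (Submodule.equivMapOfInjective _ (kerMap_injective hL) _).finrank_eq.symm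

theorem orbitSpace_le_ker (hL : IsUnit (Lᵀ * L)) (hR : IsUnit (Rᵀ * R)) :
    orbitSpace L R ≤ LinearMap.ker (facDeriv L R) := by
  rw [ker_facDeriv hL hR]
  exact LinearMap.map_le_range

theorem balance_eq_zero_of_mem_orbitSpace (hbal : Lᵀ * L = Rᵀ * R)
    {A : Matrix (Fin p₁ ⊕ Fin p₂) (Fin r) ℝ} (hA : A ∈ orbitSpace L R) :
    balance L R A = 0 := by
  obtain ⟨M, hM, rfl⟩ := hA
  have hM' : Mᵀ = -M := hM
  simp only [balance, kerMap_apply, toRows₁_fromRows, toRows₂_fromRows, hM', transpose_mul,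
    Matrix.mul_neg, Matrix.neg_mul, neg_neg,
    ← Matrix.mul_assoc, hbal]
  rw [Matrix.mul_assoc M, Matrix.mul_assoc M, hbal]
  abel

end Kernel

/-! ### Norm bounds -/

section NormBounds

variable {p₁ p₂ r : ℕ} {L : Matrix (Fin p₁) (Fin r) ℝ} {R : Matrix (Fin p₂) (Fin r) ℝ}

theorem norm_mul_eq_of_gram_eq {p q : ℕ} {Q : Matrix (Fin p) (Fin r) ℝ}
    {Q' : Matrix (Fin q) (Fin r) ℝ} (h : Qᵀ * Q = Q'ᵀ * Q') {n : ℕ}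
    (B : Matrix (Fin r) (Fin n) ℝ) : ‖Q * B‖ ^ 2 = ‖Q' * B‖ ^ 2 := by
  rw [← real_inner_self_eq_norm_sq, ← real_inner_self_eq_norm_sq, inner_mul_left_eq,
    inner_mul_left_eq, ← Matrix.mul_assoc, ← Matrix.mul_assoc, h]

theorem norm_sq_eq_toRows (A : Matrix (Fin p₁ ⊕ Fin p₂) (Fin r) ℝ) :
    ‖A‖ ^ 2 = ‖A.toRows₁‖ ^ 2 + ‖A.toRows₂‖ ^ 2 := by
  simp only [← real_inner_self_eq_norm_sq, inner_eq_toRows A]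

/-- A bound for the multiplication by `Q` also holds for the multiplication by its adjoint. -/
theorem norm_transpose_mul_le {p : ℕ} {Q : Matrix (Fin p) (Fin r) ℝ} {c : ℝ} (hc : 0 ≤ c) {n : ℕ}
    (h : ∀ B : Matrix (Fin r) (Fin n) ℝ, ‖Q * B‖ ^ 2 ≤ c * ‖B‖ ^ 2)
    (B : Matrix (Fin p) (Fin n) ℝ) : ‖Qᵀ * B‖ ^ 2 ≤ c * ‖B‖ ^ 2 := by
  have h1 : ‖Qᵀ * B‖ ^ 2 = ⟪Q * (Qᵀ * B), B⟫ := by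
    rw [inner_mul_left_eq, real_inner_self_eq_norm_sq]
  have h2 := real_inner_le_norm (Q * (Qᵀ * B)) B
  have h3 := h (Qᵀ * B)
  rcases (norm_nonneg (Qᵀ * B)).eq_or_lt with h0 | h0
  · rw [← h0, zero_pow two_ne_zero]
    exact mul_nonneg hc (sq_nonneg _)
  have h4 : (‖Qᵀ * B‖ ^ 2) * ‖Qᵀ * B‖ ^ 2 ≤ (c * ‖B‖ ^ 2) * ‖Qᵀ * B‖ ^ 2 := by
    calc (‖Qᵀ * B‖ ^ 2) * ‖Qᵀ * B‖ ^ 2 ≤ (‖Q * (Qᵀ * B)‖ * ‖B‖) * (‖Q * (Qᵀ * B)‖ * ‖B‖) := by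
          rw [← h1] at h2
          exact mul_self_le_mul_self (sq_nonneg _) h2
      _ = ‖Q * (Qᵀ * B)‖ ^ 2 * ‖B‖ ^ 2 := by ring
      _ ≤ (c * ‖Qᵀ * B‖ ^ 2) * ‖B‖ ^ 2 := by gcongr
      _ = _ := by ring
  exact le_of_mul_le_mul_right h4 (pow_pos h0 2)

theorem norm_facDeriv_sq (A : Matrix (Fin p₁ ⊕ Fin p₂) (Fin r) ℝ) :
    ‖facDeriv L R A‖ ^ 2 = ‖L * A.toRows₂ᵀ‖ ^ 2 + 2 * ⟪A.toRows₂ᵀ * R, Lᵀ * A.toRows₁⟫ +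
      ‖R * A.toRows₁ᵀ‖ ^ 2 := by
  rw [facDeriv_apply, norm_add_sq_real, inner_mul_left_eq, ← Matrix.mul_assoc,
    real_inner_comm, inner_mul_right_eq, transpose_transpose, real_inner_comm,
    ← frobenius_norm_transpose (A.toRows₁ * Rᵀ), transpose_mul, transpose_transpose]

variable {c : ℝ}

theorem norm_facDeriv_sq_le (hbal : Lᵀ * L = Rᵀ * R)
    (h : ∀ {n : ℕ} (B : Matrix (Fin r) (Fin n) ℝ), ‖L * B‖ ^ 2 ≤ c * ‖B‖ ^ 2)
    (A : Matrix (Fin p₁ ⊕ Fin p₂) (Fin r) ℝ) : ‖facDeriv L R A‖ ^ 2 ≤ 2 * c * ‖A‖ ^ 2 := by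
  have h1 := h A.toRows₂ᵀ
  have h2 := h A.toRows₁ᵀ
  rw [frobenius_norm_transpose] at h1 h2
  rw [norm_mul_eq_of_gram_eq hbal A.toRows₁ᵀ] at h2
  have h3 : ‖facDeriv L R A‖ ^ 2 ≤ 2 * (‖L * A.toRows₂ᵀ‖ ^ 2 + ‖R * A.toRows₁ᵀ‖ ^ 2) := by
    rw [← frobenius_norm_transpose (R * A.toRows₁ᵀ), transpose_mul, transpose_transpose,
      facDeriv_apply]
    exact (pow_le_pow_left₀ (norm_nonneg _) (norm_add_le _ _) 2).trans add_sq_le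
  rw [norm_sq_eq_toRows A]
  linarith

/-- On `(ker τ)ᗮ` the cross term `2 ⟪L A_Rᵀ, A_L Rᵀ⟫` of `‖τ(A)‖²` is `2 ‖Lᵀ A_L‖² ≥ 0`. -/
theorem le_norm_facDeriv_sq (hL : IsUnit (Lᵀ * L)) (hR : IsUnit (Rᵀ * R)) (hbal : Lᵀ * L = Rᵀ * R)
    (h : ∀ {n : ℕ} (B : Matrix (Fin r) (Fin n) ℝ), c * ‖B‖ ^ 2 ≤ ‖L * B‖ ^ 2)
    {A : Matrix (Fin p₁ ⊕ Fin p₂) (Fin r) ℝ} (hA : A ∈ (LinearMap.ker (facDeriv L R))ᗮ) :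
    c * ‖A‖ ^ 2 ≤ ‖facDeriv L R A‖ ^ 2 := by
  have h1 := h A.toRows₂ᵀ
  have h2 := h A.toRows₁ᵀ
  rw [frobenius_norm_transpose] at h1 h2
  rw [norm_mul_eq_of_gram_eq hbal A.toRows₁ᵀ] at h2
  rw [norm_facDeriv_sq, (mem_ker_facDeriv_orthogonal hL hR).mp hA, real_inner_self_eq_norm_sq,
    norm_sq_eq_toRows A]
  nlinarith [sq_nonneg ‖A.toRows₂ᵀ * R‖]

/-- `b(A)` is `E + Eᵀ` with `E = Lᵀ A_L - Rᵀ A_R`, and `‖E‖² ≤ 2 c ‖A‖²`. -/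
theorem norm_balance_sq_le (hc : 0 ≤ c) (hbal : Lᵀ * L = Rᵀ * R)
    (h : ∀ {n : ℕ} (B : Matrix (Fin r) (Fin n) ℝ), ‖L * B‖ ^ 2 ≤ c * ‖B‖ ^ 2)
    (A : Matrix (Fin p₁ ⊕ Fin p₂) (Fin r) ℝ) : ‖balance L R A‖ ^ 2 ≤ 8 * c * ‖A‖ ^ 2 := by
  have h1 := norm_transpose_mul_le hc (fun B => h B) A.toRows₁
  have h2 := norm_transpose_mul_le (Q := R) hc
    (fun B => (norm_mul_eq_of_gram_eq hbal B).symm.trans_le (h B)) A.toRows₂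
  have h3 : balance L R A = (Lᵀ * A.toRows₁ - Rᵀ * A.toRows₂) +
      (Lᵀ * A.toRows₁ - Rᵀ * A.toRows₂)ᵀ := by
    simp only [balance, transpose_sub, transpose_mul, transpose_transpose]
    abel
  have h4 : ‖balance L R A‖ ≤ 2 * (‖Lᵀ * A.toRows₁‖ + ‖Rᵀ * A.toRows₂‖) := by
    rw [h3]
    refine (norm_add_le _ _).trans ?_
    rw [frobenius_norm_transpose]
    linarith [norm_sub_le (Lᵀ * A.toRows₁) (Rᵀ * A.toRows₂)]
  have h5 := pow_le_pow_left₀ (norm_nonneg _) h4 2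
  rw [norm_sq_eq_toRows A]
  nlinarith [sq_nonneg (‖Lᵀ * A.toRows₁‖ - ‖Rᵀ * A.toRows₂‖)]

end NormBounds

/-! ### Singular values of a balanced factorization -/

section SingularValues

/-- A positive square root of an eigenvalue of `T* T` is one of the first `rank T` singular
values. -/
theorem exists_singularValues_eq {E F : Type*} [NormedAddCommGroup E] [InnerProductSpace ℝ E]
    [FiniteDimensional ℝ E] [NormedAddCommGroup F] [InnerProductSpace ℝ F] [FiniteDimensional ℝ F]
    (T : E →ₗ[ℝ] F) {κ : ℝ} (hκ : 0 < κ) {w : E} (hw : w ≠ 0)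
    (h : LinearMap.adjoint T (T w) = κ ^ 2 • w) :
    ∃ i < finrank ℝ (LinearMap.range T), T.singularValues i = κ := by
  have hev : End.HasEigenvalue (LinearMap.adjoint T ∘ₗ T) (κ ^ 2) :=
    End.hasEigenvalue_of_hasEigenvector ⟨End.mem_eigenspace_iff.mpr h, hw⟩
  obtain ⟨i, hi⟩ := T.isSymmetric_adjoint_comp_self.exists_eigenvalues_eq rfl hev
  have hσ : T.singularValues i = κ := by
    rw [← T.sq_singularValues_fin rfl i] at hi
    exact (pow_left_inj₀ (T.singularValues_nonneg _) hκ.le two_ne_zero).mp (by simpa using hi)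
  exact ⟨i, T.singularValues_pos_iff_lt_finrank_range.mp (hσ ▸ hκ), hσ⟩

variable {p₁ p₂ r : ℕ} {L : Matrix (Fin p₁) (Fin r) ℝ} {R : Matrix (Fin p₂) (Fin r) ℝ}

theorem finrank_range_toEuclideanLin (X : Matrix (Fin p₁) (Fin p₂) ℝ) :
    finrank ℝ (LinearMap.range (Matrix.toEuclideanLin X)) = X.rank := by
  rw [Matrix.rank_eq_finrank_range_toLin X (PiLp.basisFun 2 ℝ _) (PiLp.basisFun 2 ℝ _),
    ← toLpLin_eq_toLin]

theorem mulVec_injective_of_isUnit_gram {p : ℕ} {Q : Matrix (Fin p) (Fin r) ℝ}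
    (hQ : IsUnit (Qᵀ * Q)) {v : Fin r → ℝ} (h : Q *ᵥ v = 0) : v = 0 := by
  refine (Matrix.mulVec_injective_iff_isUnit.mpr hQ) ?_
  rw [← Matrix.mulVec_mulVec, h]
  simp

theorem gram_eigenvalue_pos {p : ℕ} {Q : Matrix (Fin p) (Fin r) ℝ} (hQ : IsUnit (Qᵀ * Q))
    {κ : ℝ} {v : Fin r → ℝ} (hv : v ≠ 0) (h : (Qᵀ * Q) *ᵥ v = κ • v) : 0 < κ := by
  have h1 : (Q *ᵥ v) ⬝ᵥ (Q *ᵥ v) = κ * (v ⬝ᵥ v) := by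
    rw [Matrix.dotProduct_mulVec, ← Matrix.mulVec_transpose, Matrix.mulVec_mulVec, h,
      smul_dotProduct, smul_eq_mul]
  have h2 : 0 < (Q *ᵥ v) ⬝ᵥ (Q *ᵥ v) := by
    have hne : Q *ᵥ v ≠ 0 := fun h0 => hv (mulVec_injective_of_isUnit_gram hQ h0)
    simpa using (Matrix.dotProduct_star_self_pos_iff (v := Q *ᵥ v)).mpr hne
  have h3 : 0 < v ⬝ᵥ v := by
    simpa using (Matrix.dotProduct_star_self_pos_iff (v := v)).mpr hv
  rw [h1] at h2
  exact (mul_pos_iff_of_pos_right h3).mp h2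

/-- At a balanced factorization the eigenvalues of `Lᵀ L` are singular values of `L Rᵀ`: if
`Lᵀ L v = κ v`, then `R v` is an eigenvector of `(L Rᵀ)ᵀ (L Rᵀ)` with eigenvalue `κ²`. -/
theorem sigma_bounds_of_gram_eigenvector (hL : IsUnit (Lᵀ * L)) (hR : IsUnit (Rᵀ * R))
    (hbal : Lᵀ * L = Rᵀ * R) {κ : ℝ} {v : Fin r → ℝ} (hv : v ≠ 0)
    (h : (Lᵀ * L) *ᵥ v = κ • v) :
    sigma (L * Rᵀ) r ≤ κ ∧ κ ≤ sigma (L * Rᵀ) 1 := by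
  have hκ := gram_eigenvalue_pos hL hv h
  have hrank : (L * Rᵀ).rank = r := rank_eq_of_isUnit L Rᵀ rfl _ _ (isUnit_mul_mul hL hR)
  have hw : (WithLp.toLp 2 (R *ᵥ v) : EuclideanSpace ℝ (Fin p₂)) ≠ 0 := by
    intro h0
    exact hv (mulVec_injective_of_isUnit_gram hR (by simpa using h0))
  have hX : (L * Rᵀ)ᵀ *ᵥ ((L * Rᵀ) *ᵥ (R *ᵥ v)) = κ ^ 2 • (R *ᵥ v) := by
    have e : (L * Rᵀ)ᵀ * (L * Rᵀ) * R = R * ((Lᵀ * L) * (Rᵀ * R)) := by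
      simp only [transpose_mul, transpose_transpose, Matrix.mul_assoc]
    rw [Matrix.mulVec_mulVec, Matrix.mulVec_mulVec, e, ← hbal, ← Matrix.mulVec_mulVec,
      ← Matrix.mulVec_mulVec, h, Matrix.mulVec_smul, h, smul_smul, Matrix.mulVec_smul, sq]
  obtain ⟨i, hi, hσ⟩ := exists_singularValues_eq (Matrix.toEuclideanLin (L * Rᵀ)) hκ hw (by
    rw [← Matrix.toEuclideanLin_conjTranspose_eq_adjoint, conjTranspose_eq_transpose_of_trivial]
    exact congrArg (WithLp.toLp 2) hX)
  rw [finrank_range_toEuclideanLin, hrank] at hi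
  rw [← hσ]
  exact ⟨LinearMap.singularValues_antitone _ (by omega),
    LinearMap.singularValues_antitone _ (by omega)⟩

theorem posSemidef_of_eigenvector {K : Matrix (Fin r) (Fin r) ℝ} (hK : K.IsHermitian)
    (h : ∀ (κ : ℝ) (v : Fin r → ℝ), v ≠ 0 → K *ᵥ v = κ • v → 0 ≤ κ) : K.PosSemidef := by
  rw [hK.posSemidef_iff_eigenvalues_nonneg]
  intro i
  refine h _ _ ?_ (hK.mulVec_eigenvectorBasis i)
  have := hK.eigenvectorBasis.orthonormal.ne_zero i
  simpa using this

theorem inner_mul_nonneg_of_posSemidef {K : Matrix (Fin r) (Fin r) ℝ} (hK : K.PosSemidef) {n : ℕ}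
    (B : Matrix (Fin r) (Fin n) ℝ) : 0 ≤ ⟪B, K * B⟫ := by
  rw [inner_eq_trace, ← Matrix.mul_assoc]
  simpa using (hK.conjTranspose_mul_mul_same B).trace_nonneg

theorem gram_isHermitian (L : Matrix (Fin p₁) (Fin r) ℝ) : (Lᵀ * L).IsHermitian := by
  simp [Matrix.IsHermitian, conjTranspose_eq_transpose_of_trivial]

theorem sigma_mul_le_norm_mul_sq (hL : IsUnit (Lᵀ * L)) (hR : IsUnit (Rᵀ * R))
    (hbal : Lᵀ * L = Rᵀ * R) {n : ℕ} (B : Matrix (Fin r) (Fin n) ℝ) :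
    sigma (L * Rᵀ) r * ‖B‖ ^ 2 ≤ ‖L * B‖ ^ 2 := by
  have hps : (Lᵀ * L - sigma (L * Rᵀ) r • (1 : Matrix (Fin r) (Fin r) ℝ)).PosSemidef := by
    refine posSemidef_of_eigenvector
      ((gram_isHermitian L).sub (by simp [Matrix.IsHermitian])) fun κ v hv hκ => ?_
    rw [Matrix.sub_mulVec, Matrix.smul_mulVec, Matrix.one_mulVec, sub_eq_iff_eq_add,
      ← add_smul] at hκ
    linarith [(sigma_bounds_of_gram_eigenvector hL hR hbal hv hκ).1]
  have h := inner_mul_nonneg_of_posSemidef hps B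
  rw [Matrix.sub_mul, inner_sub_right, Matrix.smul_mul, Matrix.one_mul, real_inner_smul_right,
    Matrix.mul_assoc, ← inner_mul_left_eq] at h
  simp only [real_inner_self_eq_norm_sq] at h
  linarith

theorem norm_mul_sq_le_sigma_mul (hL : IsUnit (Lᵀ * L)) (hR : IsUnit (Rᵀ * R))
    (hbal : Lᵀ * L = Rᵀ * R) {n : ℕ} (B : Matrix (Fin r) (Fin n) ℝ) :
    ‖L * B‖ ^ 2 ≤ sigma (L * Rᵀ) 1 * ‖B‖ ^ 2 := by
  have hps : (sigma (L * Rᵀ) 1 • (1 : Matrix (Fin r) (Fin r) ℝ) - Lᵀ * L).PosSemidef := by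
    refine posSemidef_of_eigenvector
      (Matrix.IsHermitian.sub (by simp [Matrix.IsHermitian]) (gram_isHermitian L))
      fun κ v hv hκ => ?_
    have hκ' : (Lᵀ * L) *ᵥ v = (sigma (L * Rᵀ) 1 - κ) • v := by
      rw [Matrix.sub_mulVec, Matrix.smul_mulVec, Matrix.one_mulVec] at hκ
      rw [sub_smul, ← hκ, sub_sub_cancel]
    linarith [(sigma_bounds_of_gram_eigenvector hL hR hbal hv hκ').2]
  have h := inner_mul_nonneg_of_posSemidef hps B
  rw [Matrix.sub_mul, inner_sub_right, Matrix.smul_mul, Matrix.one_mul, real_inner_smul_right,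
    Matrix.mul_assoc, ← inner_mul_left_eq] at h
  simp only [real_inner_self_eq_norm_sq] at h
  linarith

theorem sigma_nonneg (X : Matrix (Fin p₁) (Fin p₂) ℝ) (i : ℕ) : 0 ≤ sigma X i :=
  LinearMap.singularValues_nonneg _ _

end SingularValues

/-! ### Singular value decompositions -/

section SVD

variable {p₁ p₂ r : ℕ} {L : Matrix (Fin p₁) (Fin r) ℝ} {R : Matrix (Fin p₂) (Fin r) ℝ}

theorem mul_transpose_add_of_orthogonal {p : ℕ} (hr : r ≤ p) {U : Matrix (Fin p) (Fin r) ℝ}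
    {U' : Matrix (Fin p) (Fin (p - r)) ℝ} (h1 : Uᵀ * U = 1) (h2 : U'ᵀ * U' = 1)
    (h3 : Uᵀ * U' = 0) : U * Uᵀ + U' * U'ᵀ = 1 := by
  have h3' : U'ᵀ * U = 0 := by simpa using congrArg transpose h3
  have h : (fromCols U U')ᵀ * fromCols U U' = 1 := by
    rw [transpose_fromCols, fromRows_mul_fromCols, h1, h2, h3, h3', fromBlocks_one]
  have hcard : Fintype.card (Fin r ⊕ Fin (p - r)) = Fintype.card (Fin p) := by
    simp
    omega
  have h4 := (Matrix.mul_eq_one_comm_of_card_eq _ _ ℝ hcard).mp h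
  rwa [transpose_fromCols, fromCols_mul_fromRows] at h4

/-- If `Q'` has full column rank, then `Q` has the column space of `Q Q'ᵀ = U Z`, so it is fixed by
the projection `U Uᵀ`. -/
theorem eq_mul_transpose_mul_of_svd {p q : ℕ} {Q : Matrix (Fin p) (Fin r) ℝ}
    {Q' : Matrix (Fin q) (Fin r) ℝ} {U : Matrix (Fin p) (Fin r) ℝ} {Z : Matrix (Fin r) (Fin q) ℝ}
    (hQ' : IsUnit (Q'ᵀ * Q')) (hU : Uᵀ * U = 1) (h : Q * Q'ᵀ = U * Z) : Q = U * (Uᵀ * Q) := by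
  have h1 : Q * (Q'ᵀ * Q') = U * (Uᵀ * Q) * (Q'ᵀ * Q') := by
    rw [← Matrix.mul_assoc, h]
    have : U * (Uᵀ * Q) * (Q'ᵀ * Q') = U * (Uᵀ * (Q * Q'ᵀ) * Q') := by
      simp only [Matrix.mul_assoc]
    rw [this, h, ← Matrix.mul_assoc Uᵀ, hU, Matrix.one_mul, Matrix.mul_assoc]
  have h2 := congrArg (· * (Q'ᵀ * Q')⁻¹) h1
  simpa only [Matrix.mul_assoc Q, Matrix.mul_assoc (U * (Uᵀ * Q)),
    mul_nonsing_inv _ ((isUnit_iff_isUnit_det _).mp hQ'), Matrix.mul_one] using h2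

variable {U : Matrix (Fin p₁) (Fin r) ℝ} {U' : Matrix (Fin p₁) (Fin (p₁ - r)) ℝ} {s : Fin r → ℝ}
  {V : Matrix (Fin p₂) (Fin r) ℝ} {V' : Matrix (Fin p₂) (Fin (p₂ - r)) ℝ}

theorem IsSVD.left_eq (h : IsSVD (L * Rᵀ) U U' s V V') (hR : IsUnit (Rᵀ * R)) :
    L = U * (Uᵀ * L) :=
  eq_mul_transpose_mul_of_svd hR h.U_orth (h.eq.trans (Matrix.mul_assoc _ _ _))

theorem IsSVD.right_eq (h : IsSVD (L * Rᵀ) U U' s V V') (hL : IsUnit (Lᵀ * L)) :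
    R = V * (Vᵀ * R) := by
  refine eq_mul_transpose_mul_of_svd (Z := diagonal s * Uᵀ) hL h.V_orth ?_
  simpa [Matrix.mul_assoc] using congrArg transpose h.eq

theorem gram_eq_of_eq_mul {p : ℕ} {Q : Matrix (Fin p) (Fin r) ℝ} {U : Matrix (Fin p) (Fin r) ℝ}
    (hU : Uᵀ * U = 1) (h : Q = U * (Uᵀ * Q)) : (Uᵀ * Q)ᵀ * (Uᵀ * Q) = Qᵀ * Q := by
  conv_rhs => rw [h]
  rw [transpose_mul U, Matrix.mul_assoc, ← Matrix.mul_assoc Uᵀ U, hU, Matrix.one_mul]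

theorem isUnit_of_gram {P : Matrix (Fin r) (Fin r) ℝ} (h : IsUnit (Pᵀ * P)) : IsUnit P := by
  rw [isUnit_iff_isUnit_det, det_mul, det_transpose] at h
  exact (isUnit_iff_isUnit_det _).mpr (isUnit_of_mul_isUnit_left h)

theorem le_of_isUnit_gram {p : ℕ} {Q : Matrix (Fin p) (Fin r) ℝ} (h : IsUnit (Qᵀ * Q)) :
    r ≤ p := by
  have h1 : (Qᵀ * Q).rank = r := by simpa using rank_of_isUnit _ h
  have h2 : Q.rank ≤ p := by simpa using rank_le_card_height Q
  rw [rank_transpose_mul_self] at h1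
  omega

theorem xiMat_eq_facDeriv (hL : IsUnit (Lᵀ * L)) (hR : IsUnit (Rᵀ * R))
    (h : IsSVD (L * Rᵀ) U U' s V V') (A : Matrix (Fin p₁ ⊕ Fin p₂) (Fin r) ℝ) :
    xiMat L R U U' V V' A = facDeriv L R A := by
  have hUU := mul_transpose_add_of_orthogonal (le_of_isUnit_gram hL) h.U_orth h.U'_orth h.U_perp
  have hVV := mul_transpose_add_of_orthogonal (le_of_isUnit_gram hR) h.V_orth h.V'_orth h.V_perp
  have hl := h.left_eq hR
  have hr := h.right_eq hL
  have e1 : xiMat L R U U' V V' A =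
      (U * (Uᵀ * L)) * A.toRows₂ᵀ * (V * Vᵀ + V' * V'ᵀ) +
        (U * Uᵀ + U' * U'ᵀ) * A.toRows₁ * (V * (Vᵀ * R))ᵀ := by
    rw [xiMat, fromCols_mul_fromBlocks, transpose_fromCols, fromCols_mul_fromRows]
    simp only [transpose_mul V (Vᵀ * R), Matrix.mul_add, Matrix.add_mul, Matrix.mul_zero, add_zero,
      Matrix.mul_assoc]
    abel
  rw [e1, hUU, hVV, ← hl, ← hr, Matrix.mul_one, Matrix.one_mul, facDeriv_apply]

/-- The defining equation of `sSpace P₁ P₂` becomes `K (M + Mᵀ) + (M + Mᵀ) K = 0` under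
`S = P₁ M P₂ᵀ`, with `K = P₁ᵀ P₁ = P₂ᵀ P₂` positive definite. -/
theorem mem_sSpace_iff {P₁ P₂ : Matrix (Fin r) (Fin r) ℝ} (h₁ : IsUnit P₁) (h₂ : IsUnit P₂)
    (hbal : P₁ᵀ * P₁ = P₂ᵀ * P₂) {S : Matrix (Fin r) (Fin r) ℝ} :
    S ∈ sSpace P₁ P₂ ↔ ∃ M ∈ skewMat r, S = P₁ * M * P₂ᵀ := by
  have hd₁ := (isUnit_iff_isUnit_det _).mp h₁
  have hd₂ : IsUnit P₂ᵀ.det := by rw [det_transpose]; exact (isUnit_iff_isUnit_det _).mp h₂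
  have key : ∀ M : Matrix (Fin r) (Fin r) ℝ, P₁ * M * P₂ᵀ ∈ sSpace P₁ P₂ ↔
      (P₁ᵀ * P₁) * (M + Mᵀ) + (M + Mᵀ) * (P₁ᵀ * P₁) = 0 := by
    intro M
    have e1 : P₁ᵀ * (P₁ * M * P₂ᵀ) * P₂ᵀ⁻¹ = P₁ᵀ * P₁ * M := by
      rw [Matrix.mul_assoc, Matrix.mul_assoc (P₁ * M), mul_nonsing_inv _ hd₂, Matrix.mul_one,
        ← Matrix.mul_assoc]
    have e2 : P₁⁻¹ * (P₁ * M * P₂ᵀ) * P₂ = M * (P₁ᵀ * P₁) := by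
      rw [Matrix.mul_assoc P₁, ← Matrix.mul_assoc P₁⁻¹, nonsing_inv_mul _ hd₁, Matrix.one_mul,
        Matrix.mul_assoc, hbal]
    have e3 : P₁ * M * P₂ᵀ ∈ sSpace P₁ P₂ ↔
        P₁ᵀ * (P₁ * M * P₂ᵀ) * P₂ᵀ⁻¹ + (P₁ᵀ * (P₁ * M * P₂ᵀ) * P₂ᵀ⁻¹)ᵀ +
          P₁⁻¹ * (P₁ * M * P₂ᵀ) * P₂ + (P₁⁻¹ * (P₁ * M * P₂ᵀ) * P₂)ᵀ = 0 := Iff.rfl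
    rw [e3, e1, e2]
    have e4 : P₁ᵀ * P₁ * M + (P₁ᵀ * P₁ * M)ᵀ + M * (P₁ᵀ * P₁) + (M * (P₁ᵀ * P₁))ᵀ =
        (P₁ᵀ * P₁) * (M + Mᵀ) + (M + Mᵀ) * (P₁ᵀ * P₁) := by
      simp only [transpose_mul, transpose_transpose, Matrix.mul_add, Matrix.add_mul]
      abel
    rw [e4]
  constructor
  · intro hS
    obtain ⟨M, hM⟩ : ∃ M, S = P₁ * M * P₂ᵀ := by
      refine ⟨P₁⁻¹ * S * P₂ᵀ⁻¹, ?_⟩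
      rw [Matrix.mul_assoc P₁⁻¹, ← Matrix.mul_assoc P₁, mul_nonsing_inv _ hd₁, Matrix.one_mul,
        Matrix.mul_assoc, nonsing_inv_mul _ hd₂, Matrix.mul_one]
    refine ⟨M, ?_, hM⟩
    rw [hM, key] at hS
    generalize hD : M + Mᵀ = D at hS
    have hDt : Dᵀ = D := by rw [← hD, transpose_add, transpose_transpose, add_comm]
    -- Pairing the equation `K D + D K = 0` with `D = M + Mᵀ` gives `P₁ D = 0`.
    have h0 : ⟪D, (P₁ᵀ * P₁) * D + D * (P₁ᵀ * P₁)⟫ = 2 * ‖P₁ * D‖ ^ 2 := by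
      have e : ⟪D, D * (P₁ᵀ * P₁)⟫ = ⟪D, (P₁ᵀ * P₁) * D⟫ := by
        rw [← inner_transpose_transpose]
        simp only [transpose_mul, transpose_transpose, hDt]
      rw [inner_add_right, e, Matrix.mul_assoc, ← inner_mul_left_eq, real_inner_self_eq_norm_sq]
      ring
    rw [hS, inner_zero_right] at h0
    have h1 : P₁ * D = 0 := by simpa using h0.symm
    have h2 : P₁⁻¹ * (P₁ * D) = 0 := by rw [h1, Matrix.mul_zero]
    rw [← Matrix.mul_assoc, nonsing_inv_mul _ hd₁, Matrix.one_mul] at h2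
    rw [mem_skewMat]
    rw [h2, add_comm] at hD
    exact eq_neg_of_add_eq_zero_left hD
  · rintro ⟨M, hM, rfl⟩
    rw [key, mem_skewMat.mp hM]
    simp

theorem nullTilde_eq_orbitSpace (hL : IsUnit (Lᵀ * L)) (hR : IsUnit (Rᵀ * R))
    (hbal : Lᵀ * L = Rᵀ * R) (h : IsSVD (L * Rᵀ) U U' s V V') :
    nullTilde (Uᵀ * L) (Vᵀ * R) U V = orbitSpace L R := by
  have hl := h.left_eq hR
  have hr := h.right_eq hL
  have g1 := gram_eq_of_eq_mul h.U_orth hl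
  have g2 := gram_eq_of_eq_mul h.V_orth hr
  generalize hP₁ : Uᵀ * L = P₁ at *
  generalize hP₂ : Vᵀ * R = P₂ at *
  have h₁ : IsUnit P₁ := isUnit_of_gram (g1 ▸ hL)
  have h₂ : IsUnit P₂ := isUnit_of_gram (g2 ▸ hR)
  have hd₁ : IsUnit P₁ᵀ.det := by rw [det_transpose]; exact (isUnit_iff_isUnit_det _).mp h₁
  have hd₂ : IsUnit P₂ᵀ.det := by rw [det_transpose]; exact (isUnit_iff_isUnit_det _).mp h₂
  have key : ∀ M, fromRows (U * (P₁ * M * P₂ᵀ) * P₂ᵀ⁻¹) (-(V * (P₁ * M * P₂ᵀ)ᵀ * P₁ᵀ⁻¹)) =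
      kerMap L R M := by
    intro M
    rw [kerMap_apply, hl, hr]
    congr 1
    · rw [Matrix.mul_assoc, Matrix.mul_assoc (P₁ * M), mul_nonsing_inv _ hd₂]
      simp only [Matrix.mul_one, Matrix.mul_assoc]
    · rw [transpose_mul, transpose_mul, transpose_transpose, ← Matrix.mul_assoc P₂,
        Matrix.mul_assoc V, Matrix.mul_assoc (P₂ * Mᵀ), mul_nonsing_inv _ hd₁]
      simp only [Matrix.mul_one, Matrix.mul_assoc]
  ext A
  constructor
  · rintro ⟨S, hS, rfl⟩
    obtain ⟨M, hM, rfl⟩ := (mem_sSpace_iff h₁ h₂ (by rw [g1, g2, hbal])).mp hS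
    exact ⟨M, hM, (key M).symm⟩
  · rintro ⟨M, hM, rfl⟩
    exact ⟨_, (mem_sSpace_iff h₁ h₂ (by rw [g1, g2, hbal])).mpr ⟨M, hM, rfl⟩, (key M).symm⟩

theorem nullBar_eq_ker_orthogonal (hL : IsUnit (Lᵀ * L)) (hR : IsUnit (Rᵀ * R))
    (h : IsSVD (L * Rᵀ) U U' s V V') :
    nullBar (Uᵀ * L) (Vᵀ * R) U U' V V' = (LinearMap.ker (facDeriv L R))ᗮ := by
  have hUU := mul_transpose_add_of_orthogonal (le_of_isUnit_gram hL) h.U_orth h.U'_orth h.U_perp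
  have hVV := mul_transpose_add_of_orthogonal (le_of_isUnit_gram hR) h.V_orth h.V'_orth h.V_perp
  have hl := h.left_eq hR
  have hr := h.right_eq hL
  have g1 := gram_eq_of_eq_mul h.U_orth hl
  have g2 := gram_eq_of_eq_mul h.V_orth hr
  ext A
  rw [mem_ker_facDeriv_orthogonal hL hR]
  generalize hP₁ : Uᵀ * L = P₁ at *
  generalize hP₂ : Vᵀ * R = P₂ at *
  have h₁ : IsUnit P₁ := isUnit_of_gram (g1 ▸ hL)
  have h₂ : IsUnit P₂ := isUnit_of_gram (g2 ▸ hR)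
  have hd₁ : IsUnit P₁ᵀ.det := by rw [det_transpose]; exact (isUnit_iff_isUnit_det _).mp h₁
  have hd₂ : IsUnit P₂ᵀ.det := by rw [det_transpose]; exact (isUnit_iff_isUnit_det _).mp h₂
  have hd₂' : IsUnit P₂.det := by rwa [det_transpose] at hd₂
  rw [hl, hr]
  constructor
  · rintro ⟨S, D₁, D₂, rfl⟩
    have e1 : Uᵀ * ((U * S * P₂ * P₂ᵀ + U' * D₁) * P₂ᵀ⁻¹) = S * P₂ := by
      rw [← Matrix.mul_assoc, Matrix.mul_add, ← Matrix.mul_assoc, ← Matrix.mul_assoc,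
        ← Matrix.mul_assoc, ← Matrix.mul_assoc, h.U_orth, h.U_perp, Matrix.zero_mul, add_zero,
        Matrix.one_mul, Matrix.mul_assoc, mul_nonsing_inv _ hd₂, Matrix.mul_one]
    have e2 : Vᵀ * ((V * Sᵀ * P₁ * P₁ᵀ + V' * D₂) * P₁ᵀ⁻¹) = Sᵀ * P₁ := by
      rw [← Matrix.mul_assoc, Matrix.mul_add, ← Matrix.mul_assoc, ← Matrix.mul_assoc,
        ← Matrix.mul_assoc, ← Matrix.mul_assoc, h.V_orth, h.V_perp, Matrix.zero_mul, add_zero,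
        Matrix.one_mul, Matrix.mul_assoc, mul_nonsing_inv _ hd₁, Matrix.mul_one]
    rw [toRows₁_fromRows, toRows₂_fromRows, transpose_mul, Matrix.mul_assoc, e1,
      ← Matrix.mul_assoc _ V, ← transpose_transpose V, ← transpose_mul, transpose_transpose, e2]
    simp [Matrix.mul_assoc]
  · intro hA
    obtain ⟨S, hS⟩ : ∃ S, S = Uᵀ * A.toRows₁ * P₂⁻¹ := ⟨_, rfl⟩
    have e1 : Uᵀ * A.toRows₁ = S * P₂ := by
      rw [hS, Matrix.mul_assoc, nonsing_inv_mul _ hd₂', Matrix.mul_one]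
    have e2 : Vᵀ * A.toRows₂ = Sᵀ * P₁ := by
      have h3 := congrArg transpose hA
      simp only [transpose_mul, transpose_transpose] at h3
      have h4 : P₂ᵀ * (Vᵀ * A.toRows₂) = P₂ᵀ * (Sᵀ * P₁) := by
        rw [← Matrix.mul_assoc P₂ᵀ Sᵀ, ← transpose_mul, ← e1, transpose_mul, transpose_transpose,
          ← Matrix.mul_assoc, ← h3, Matrix.mul_assoc]
      have h5 := congrArg (P₂ᵀ⁻¹ * ·) h4
      simpa only [← Matrix.mul_assoc, nonsing_inv_mul _ hd₂, Matrix.one_mul] using h5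
    refine ⟨S, U'ᵀ * A.toRows₁ * P₂ᵀ, V'ᵀ * A.toRows₂ * P₁ᵀ, ?_⟩
    have f1 : (U * S * P₂ * P₂ᵀ + U' * (U'ᵀ * A.toRows₁ * P₂ᵀ)) * P₂ᵀ⁻¹ = A.toRows₁ := by
      calc _ = (U * Uᵀ + U' * U'ᵀ) * A.toRows₁ * (P₂ᵀ * P₂ᵀ⁻¹) := by
            rw [Matrix.mul_assoc U, ← e1]
            simp only [Matrix.add_mul, Matrix.mul_assoc]
        _ = _ := by rw [hUU, mul_nonsing_inv _ hd₂, Matrix.mul_one, Matrix.one_mul]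
    have f2 : (V * Sᵀ * P₁ * P₁ᵀ + V' * (V'ᵀ * A.toRows₂ * P₁ᵀ)) * P₁ᵀ⁻¹ = A.toRows₂ := by
      calc _ = (V * Vᵀ + V' * V'ᵀ) * A.toRows₂ * (P₁ᵀ * P₁ᵀ⁻¹) := by
            rw [Matrix.mul_assoc V, ← e2]
            simp only [Matrix.add_mul, Matrix.mul_assoc]
        _ = _ := by rw [hVV, mul_nonsing_inv _ hd₁, Matrix.mul_one, Matrix.one_mul]
    rw [f1, f2, fromRows_toRows]

theorem nullBar_le_nullBarTilde (P₁ P₂ : Matrix (Fin r) (Fin r) ℝ) :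
    nullBar P₁ P₂ U U' V V' ≤ nullBarTilde P₁ P₂ U U' V V' := by
  rintro _ ⟨S, D₁, D₂, rfl⟩
  exact ⟨S, S, D₁, D₂, by simp, rfl⟩

end SVD

/-! ### Comparison of eigenvalues -/

section Comparison

variable {E F : Type*} [NormedAddCommGroup E] [InnerProductSpace ℝ E] [FiniteDimensional ℝ E]
  [NormedAddCommGroup F] [InnerProductSpace ℝ F]

/-- A surjective linear map identifies the orthogonal complement of its kernel with its target. -/
noncomputable def kerOrthogonalEquiv (τ : E →ₗ[ℝ] F) (hτ : Function.Surjective τ) :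
    (LinearMap.ker τ)ᗮ ≃ₗ[ℝ] F :=
  LinearEquiv.ofBijective (τ.domRestrict (LinearMap.ker τ)ᗮ) (by
    constructor
    · rw [injective_iff_map_eq_zero]
      rintro ⟨x, hx⟩ h
      have h0 : x ∈ LinearMap.ker τ ⊓ (LinearMap.ker τ)ᗮ := ⟨h, hx⟩
      rw [Submodule.inf_orthogonal_eq_bot] at h0
      exact Subtype.ext h0
    · intro y
      obtain ⟨x, rfl⟩ := hτ y
      obtain ⟨u, hu, v, hv, rfl⟩ := (LinearMap.ker τ).exists_add_mem_mem_orthogonal x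
      exact ⟨⟨v, hv⟩, by simp [LinearMap.mem_ker.mp hu]⟩)

variable [FiniteDimensional ℝ F]

theorem le_of_min_le_mul {c₀ c₁ a x y : ℝ} (h₀ : c₀ * x ≤ y) (h₁ : y ≤ c₁ * x) (hx : 0 ≤ x) :
    min (c₀ * a) (c₁ * a) * x ≤ a * y ∧ a * y ≤ max (c₁ * a) (c₀ * a) * x := by
  rcases le_total 0 a with ha | ha
  · have e0 := mul_le_mul_of_nonneg_left h₀ ha
    have e1 := mul_le_mul_of_nonneg_left h₁ ha
    have e2 := mul_le_mul_of_nonneg_right (min_le_left (c₀ * a) (c₁ * a)) hx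
    have e3 := mul_le_mul_of_nonneg_right (le_max_left (c₁ * a) (c₀ * a)) hx
    constructor <;> linarith
  · have e0 := mul_le_mul_of_nonpos_left h₀ ha
    have e1 := mul_le_mul_of_nonpos_left h₁ ha
    have e2 := mul_le_mul_of_nonneg_right (min_le_right (c₀ * a) (c₁ * a)) hx
    have e3 := mul_le_mul_of_nonneg_right (le_max_right (c₁ * a) (c₀ * a)) hx
    constructor <;> linarith

/-- Comparison of the eigenvalues of two operators whose forms satisfy `q_H = q_h ∘ τ + β`, when
the nonnegative term `β` vanishes on the orthogonal complement of `ker τ` and `τ` distorts norms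
there by bounded factors. The operator `H` vanishes on `N ≤ ker τ`, and the eigenvalues compared
are those of `H` on the orthogonal complement of `N`. The bounds for a single index `i` come from
the Courant-Fischer principle, applied to the preimages in `(ker τ)ᗮ` of eigenspaces of `h`. -/
theorem eigenvalue_comparison {H : E →ₗ[ℝ] E} {h : F →ₗ[ℝ] F} (hH : H.IsSymmetric)
    (hh : h.IsSymmetric) (hF : 1 ≤ finrank ℝ F) (τ : E →ₗ[ℝ] F) (hτ : Function.Surjective τ)
    (N : Submodule ℝ E) (hN : N ≤ LinearMap.ker τ) (hHN : ∀ x ∈ N, H x = 0) (β : E → ℝ)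
    {b c₀ c₁ : ℝ} (hform : ∀ x, ⟪H x, x⟫ = ⟪h (τ x), τ x⟫ + β x) (hβ : ∀ x, 0 ≤ β x)
    (hβb : ∀ x, β x ≤ b * ‖x‖ ^ 2) (hβ0 : ∀ x ∈ (LinearMap.ker τ)ᗮ, β x = 0)
    (hc₁ : ∀ x, ‖τ x‖ ^ 2 ≤ c₁ * ‖x‖ ^ 2)
    (hc₀ : ∀ x ∈ (LinearMap.ker τ)ᗮ, c₀ * ‖x‖ ^ 2 ≤ ‖τ x‖ ^ 2) {m : ℕ}
    (hm : finrank ℝ E = finrank ℝ F + m + finrank ℝ N) {lam lamBar : ℕ → ℝ}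
    (hlam : lam = nthLargest (eigs h))
    (hlamBar : lamBar = nthLargest (eigs H - Multiset.replicate (finrank ℝ N) 0)) :
    (∀ i, 1 ≤ i → i ≤ finrank ℝ F → min (c₀ * lam i) (c₁ * lam i) ≤ lamBar i) ∧
    (∀ i, 1 ≤ i → i ≤ finrank ℝ F + m → min (c₁ * least (eigs h)) 0 ≤ lamBar i) ∧
    (∀ i, 1 ≤ i → i ≤ finrank ℝ F + m → lamBar i ≤ c₁ * max (lam 1) 0 + b) ∧
    (∀ i, 1 ≤ i → i ≤ finrank ℝ F → lamBar (i + m) ≤ max (c₁ * lam i) (c₀ * lam i)) := by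
  obtain ⟨H', hH', hH'H, heigs⟩ := exists_restrict_orthogonal hH N hHN
  rw [heigs, add_tsub_cancel_left] at hlamBar
  subst hlam hlamBar
  have hdim : finrank ℝ Nᗮ = finrank ℝ F + m := by
    have := N.finrank_add_finrank_orthogonal
    omega
  have hform' : ∀ x : Nᗮ, ⟪H' x, x⟫ = ⟪h (τ x), τ x⟫ + β x := fun x => by
    rw [← hform, ← hH'H]
    rfl
  -- The section of `τ` with values in the orthogonal complement of its kernel.
  let ψ : F →ₗ[ℝ] Nᗮ := (Submodule.inclusion (Submodule.orthogonal_le hN)).comp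
    (kerOrthogonalEquiv τ hτ).symm.toLinearMap
  have hτψ : ∀ y, τ (ψ y) = y := fun y => (kerOrthogonalEquiv τ hτ).apply_symm_apply y
  have hψC : ∀ y, (ψ y : E) ∈ (LinearMap.ker τ)ᗮ := fun y =>
    ((kerOrthogonalEquiv τ hτ).symm y).2
  have hψ : Function.Injective ψ := fun y z hyz => by rw [← hτψ y, hyz, hτψ]
  have hψH : ∀ y, ⟪H' (ψ y), ψ y⟫ = ⟪h y, y⟫ := fun y => by
    rw [hform', hτψ, hβ0 _ (hψC y), add_zero]
  have hψ₀ : ∀ y, c₀ * ‖ψ y‖ ^ 2 ≤ ‖y‖ ^ 2 := fun y => by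
    simpa [hτψ] using hc₀ _ (hψC y)
  have hψ₁ : ∀ y, ‖y‖ ^ 2 ≤ c₁ * ‖ψ y‖ ^ 2 := fun y => by
    simpa [hτψ] using hc₁ (ψ y)
  have hmap : ∀ V : Submodule ℝ F, finrank ℝ (V.map ψ) = finrank ℝ V := fun V =>
    (Submodule.equivMapOfInjective ψ hψ V).finrank_eq.symm
  refine ⟨fun i h1 hi => ?_, fun i h1 hi => ?_, fun i h1 hi => ?_, fun i h1 hi => ?_⟩
  · obtain ⟨V, hV, hle⟩ := exists_submodule_nthLargest_le hh h1 hi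
    refine le_nthLargest_of_submodule hH' h1 (V.map ψ) (by rw [hmap, hV]) ?_
    rintro _ ⟨y, hy, rfl⟩
    rw [hψH]
    exact (le_of_min_le_mul (hψ₀ y) (hψ₁ y) (sq_nonneg _)).1.trans (hle y hy)
  · refine le_nthLargest_of_submodule hH' h1 ⊤ (by rw [finrank_top, hdim]; exact hi) ?_
    intro x _
    have e1 := least_eigs_mul_le hh hF (τ x)
    have e2 := hc₁ x
    have e3 := hβ x
    have e4 : (0 : ℝ) ≤ ‖x‖ ^ 2 := sq_nonneg _
    have e5 : (0 : ℝ) ≤ ‖τ x‖ ^ 2 := sq_nonneg _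
    rw [hform']
    rw [Submodule.coe_norm] at e4 ⊢
    rcases le_total 0 (least (eigs h)) with ha | ha
    · have f1 := mul_nonneg ha e5
      have f2 := mul_le_mul_of_nonneg_right (min_le_right (c₁ * least (eigs h)) 0) e4
      linarith
    · have f1 := mul_le_mul_of_nonpos_left e2 ha
      have f2 := mul_le_mul_of_nonneg_right (min_le_left (c₁ * least (eigs h)) 0) e4
      linarith
  · refine nthLargest_le_of_submodule hH' h1 (hi.trans hdim.ge) ⊤
      (by rw [finrank_top]; omega) ?_
    intro x _
    have e1 := inner_le_nthLargest_one hh hF (τ x)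
    have e2 := mul_le_mul_of_nonneg_left (hc₁ x) (le_max_right (nthLargest (eigs h) 1) 0)
    have e3 := mul_le_mul_of_nonneg_right (le_max_left (nthLargest (eigs h) 1) 0)
      (sq_nonneg ‖τ x‖)
    have e4 := hβb x
    rw [hform', Submodule.coe_norm]
    linarith
  · obtain ⟨V, hV, hle⟩ := exists_submodule_le_nthLargest hh h1 hi
    refine nthLargest_le_of_submodule hH' (by omega) (by omega) (V.map ψ)
      (by rw [hmap, hdim]; omega) ?_
    rintro _ ⟨y, hy, rfl⟩
    rw [hψH]
    exact (hle y hy).trans (le_of_min_le_mul (hψ₀ y) (hψ₁ y) (sq_nonneg _)).2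

end Comparison

/-! ### The differential as a map onto the tangent space -/

section TangentMap

variable {p₁ p₂ r : ℕ} {L : Matrix (Fin p₁) (Fin r) ℝ} {R : Matrix (Fin p₂) (Fin r) ℝ}

/-- The differential of the factorization, as a map onto the tangent space. -/
noncomputable def facTangent (hL : IsUnit (Lᵀ * L)) (hR : IsUnit (Rᵀ * R)) :
    Matrix (Fin p₁ ⊕ Fin p₂) (Fin r) ℝ →ₗ[ℝ] tangentSpace (rankManifold p₁ p₂ r) (L * Rᵀ) :=
  (facDeriv L R).codRestrict _ fun A => facDeriv_mem_tangentSpace A hL hR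

theorem facTangent_surjective (hL : IsUnit (Lᵀ * L)) (hR : IsUnit (Rᵀ * R)) :
    Function.Surjective (facTangent hL hR) := by
  rintro ⟨ξ, hξ⟩
  obtain ⟨A, hA⟩ := (tangentSpace_rankManifold hL hR) ▸ hξ
  exact ⟨A, Subtype.ext hA⟩

theorem ker_facTangent (hL : IsUnit (Lᵀ * L)) (hR : IsUnit (Rᵀ * R)) :
    LinearMap.ker (facTangent hL hR) = LinearMap.ker (facDeriv L R) :=
  LinearMap.ker_codRestrict _ _ _

theorem finrank_tangentSpace (hL : IsUnit (Lᵀ * L)) (hR : IsUnit (Rᵀ * R)) :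
    finrank ℝ (tangentSpace (rankManifold p₁ p₂ r) (L * Rᵀ)) + r * r = (p₁ + p₂) * r := by
  rw [tangentSpace_rankManifold hL hR, finrank_range_facDeriv hL hR]

theorem half_sq_sub_add_half_sq_add (r : ℕ) : (r ^ 2 - r) / 2 + (r ^ 2 + r) / 2 = r * r := by
  obtain ⟨k, hk⟩ : ∃ k, r ^ 2 = r + 2 * k := by
    induction r with
    | zero => exact ⟨0, rfl⟩
    | succ n ih =>
      obtain ⟨k, hk⟩ := ih
      exact ⟨k + n, by rw [add_sq, hk]; ring⟩
  rw [← sq]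
  omega

end TangentMap

end LowRank

theorem mainTheorem5 {p₁ p₂ r : ℕ} (hr : 0 < r)
    (f : Matrix (Fin p₁) (Fin p₂) ℝ → ℝ) (hf : ContDiff ℝ 2 f)
    (μ : ℝ) (hμ : 0 < μ)
    (L : Matrix (Fin p₁) (Fin r) ℝ) (R : Matrix (Fin p₂) (Fin r) ℝ)
    (X : Matrix (Fin p₁) (Fin p₂) ℝ) (hX : X = L * Rᵀ) (hrank : X.rank = r)
    (hfosp : gradient (gReg f μ) (fromRows L R) = 0) :
    -- balancedness, equality of the gradients, relation of the two Euclidean Hessians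
    Lᵀ * L = Rᵀ * R ∧
    gradient (gReg f μ) (fromRows L R) = gradient (gFac f) (fromRows L R) ∧
    (∀ A : Matrix (Fin p₁ ⊕ Fin p₂) (Fin r) ℝ,
      ⟪euclHess (gReg f μ) (fromRows L R) A, A⟫ =
        ⟪euclHess (gFac f) (fromRows L R) A, A⟫ + μ * ‖balance L R A‖ ^ 2) ∧
    -- relation of the Euclidean and the Riemannian Hessians, for every SVD of `X`
    (∀ (U : Matrix (Fin p₁) (Fin r) ℝ) (U' : Matrix (Fin p₁) (Fin (p₁ - r)) ℝ) (s : Fin r → ℝ)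
      (V : Matrix (Fin p₂) (Fin r) ℝ) (V' : Matrix (Fin p₂) (Fin (p₂ - r)) ℝ),
      IsSVD X U U' s V V' →
      (∀ A : Matrix (Fin p₁ ⊕ Fin p₂) (Fin r) ℝ,
        ∃ hA : xiMat L R U U' V V' A ∈ tangentSpace (rankManifold p₁ p₂ r) X,
          ⟪euclHess (gReg f μ) (fromRows L R) A, A⟫ =
            ⟪riemHess (rankManifold p₁ p₂ r) f X ⟨_, hA⟩, ⟨_, hA⟩⟫ +
              μ * ‖balance L R A‖ ^ 2) ∧
      (∃ ℒ : nullBar (Uᵀ * L) (Vᵀ * R) U U' V V' ≃ₗ[ℝ] tangentSpace (rankManifold p₁ p₂ r) X,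
        (∀ A, (ℒ A : Matrix (Fin p₁) (Fin p₂) ℝ) = xiMat L R U U' V V' A) ∧
        ∀ ξ : tangentSpace (rankManifold p₁ p₂ r) X,
          ⟪riemHess (rankManifold p₁ p₂ r) f X ξ, ξ⟫ =
            ⟪euclHess (gReg f μ) (fromRows L R) (ℒ.symm ξ),
              (ℒ.symm ξ : Matrix (Fin p₁ ⊕ Fin p₂) (Fin r) ℝ)⟫) ∧
      (∀ A ∈ nullTilde (Uᵀ * L) (Vᵀ * R) U V, euclHess (gReg f μ) (fromRows L R) A = 0) ∧
      (∃ ℒ' : nullBarTilde (Uᵀ * L) (Vᵀ * R) U U' V V' →ₗ[ℝ]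
          tangentSpace (rankManifold p₁ p₂ r) X,
        (∀ A, (ℒ' A : Matrix (Fin p₁) (Fin p₂) ℝ) = xiMat L R U U' V V' A) ∧
        Function.Surjective ℒ' ∧
        ∀ A : nullBarTilde (Uᵀ * L) (Vᵀ * R) U U' V V',
          ⟪euclHess (gReg f μ) (fromRows L R) A,
            (A : Matrix (Fin p₁ ⊕ Fin p₂) (Fin r) ℝ)⟫ =
            ⟪riemHess (rankManifold p₁ p₂ r) f X (ℒ' A), ℒ' A⟫ +
              μ * ‖balance L R A‖ ^ 2) ∧
      finrank ℝ (nullTilde (Uᵀ * L) (Vᵀ * R) U V) = (r ^ 2 - r) / 2) ∧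
    -- the Hessians are symmetric operators; number of their eigenvalues
    (riemHess (rankManifold p₁ p₂ r) f X).IsSymmetric ∧
    (eigs (riemHess (rankManifold p₁ p₂ r) f X)).card = (p₁ + p₂ - r) * r ∧
    (euclHess (gReg f μ) (fromRows L R)).IsSymmetric ∧
    (eigs (euclHess (gReg f μ) (fromRows L R))).card = (p₁ + p₂) * r ∧
    (r ^ 2 - r) / 2 ≤ (eigs (euclHess (gReg f μ) (fromRows L R))).count 0 ∧
    -- bounds for the eigenvalues that remain after the removal of `(r² - r) / 2` zeros
    (∀ lam lamBar : ℕ → ℝ,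
      lam = nthLargest (eigs (riemHess (rankManifold p₁ p₂ r) f X)) →
      lamBar = nthLargest (eigs (euclHess (gReg f μ) (fromRows L R)) -
        Multiset.replicate ((r ^ 2 - r) / 2) 0) →
      (∀ i, 1 ≤ i → i ≤ (p₁ + p₂ - r) * r →
        min (sigma X r * lam i) (2 * sigma X 1 * lam i) ≤ lamBar i) ∧
      (∀ i, (p₁ + p₂ - r) * r + 1 ≤ i → i ≤ (p₁ + p₂) * r - (r ^ 2 - r) / 2 →
        min (2 * sigma X 1 * least (eigs (riemHess (rankManifold p₁ p₂ r) f X))) 0 ≤ lamBar i) ∧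
      (∀ i, 1 ≤ i → i ≤ (r ^ 2 + r) / 2 →
        lamBar i ≤ 2 * sigma X 1 * (max (lam 1) 0 + 4 * μ)) ∧
      (∀ i, (r ^ 2 + r) / 2 + 1 ≤ i → i ≤ (p₁ + p₂) * r - (r ^ 2 - r) / 2 →
        lamBar i ≤ max (2 * sigma X 1 * lam (i - (r ^ 2 + r) / 2))
          (sigma X r * lam (i - (r ^ 2 + r) / 2)))) := by
  subst hX
  obtain ⟨hL, hR⟩ := isUnit_gram_of_rank hrank
  have hbal := balanced_of_gradient_eq_zero hf hμ hfosp
  have hgrad := gradient_gReg_eq (L := L) (R := R) hf μ hbal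
  have hcrit : gradient (gFac f) (fromRows L R) = 0 := hgrad ▸ hfosp
  have hformReg := inner_euclHess_gReg L R hf μ hbal
  have hformRiem := inner_riemHess_facDeriv hf hL hR hcrit
  have hform : ∀ A, ⟪euclHess (gReg f μ) (fromRows L R) A, A⟫ =
      ⟪riemHess (rankManifold p₁ p₂ r) f (L * Rᵀ) (facTangent hL hR A), facTangent hL hR A⟫ +
        μ * ‖balance L R A‖ ^ 2 := fun A => by
    rw [hformReg, real_inner_self_eq_norm_sq, ← hformRiem]
    rfl
  have hzero : ∀ A ∈ orbitSpace L R, euclHess (gReg f μ) (fromRows L R) A = 0 := by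
    intro A hA
    refine ext_inner_right ℝ fun B => ?_
    -- Both summands of the form vanish against every `B`, since `τ(A) = 0` and `b(A) = 0`.
    have hA0 : (⟨facDeriv L R A, facDeriv_mem_tangentSpace A hL hR⟩ :
        tangentSpace (rankManifold p₁ p₂ r) (L * Rᵀ)) = 0 :=
      Subtype.ext (orbitSpace_le_ker hL hR hA)
    rw [hformReg, ← hformRiem, hA0, balance_eq_zero_of_mem_orbitSpace hbal hA, map_zero]
    simp
  have hsymm : (riemHess (rankManifold p₁ p₂ r) f (L * Rᵀ)).IsSymmetric := by
    intro ξ η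
    obtain ⟨A, rfl⟩ := facTangent_surjective hL hR ξ
    obtain ⟨B, rfl⟩ := facTangent_surjective hL hR η
    have h1 := hformRiem A B
    have h2 := hformRiem B A
    rw [euclHess_isSymmetric (contDiff_gFac hf), real_inner_comm _ B, ← h1] at h2
    rw [real_inner_comm _ (facTangent hL hR A)]
    exact h2.symm
  have hHsymm := euclHess_isSymmetric (contDiff_gReg (r := r) hf μ) (fromRows L R)
  have hfinT := finrank_tangentSpace hL hR
  have hfinE : finrank ℝ (Matrix (Fin p₁ ⊕ Fin p₂) (Fin r) ℝ) = (p₁ + p₂) * r := by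
    simp [finrank_matrix]
  have hfinN := finrank_orbitSpace (R := R) hL
  have hp₁ := le_of_isUnit_gram hL
  have hp₂ := le_of_isUnit_gram hR
  have hd : finrank ℝ (tangentSpace (rankManifold p₁ p₂ r) (L * Rᵀ)) = (p₁ + p₂ - r) * r := by
    rw [Nat.sub_mul]
    omega
  have hdpos : 1 ≤ (p₁ + p₂ - r) * r := Nat.mul_pos (by omega) hr
  have harith := half_sq_sub_add_half_sq_add r
  refine ⟨hbal, hgrad, fun A => by rw [hformReg, real_inner_self_eq_norm_sq], ?_, hsymm,
    (eigs_card hsymm).trans hd, hHsymm, (eigs_card hHsymm).trans hfinE, ?_, ?_⟩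
  · intro U U' s V V' hsvd
    have hxi := xiMat_eq_facDeriv hL hR hsvd
    have hbar : nullBar (Uᵀ * L) (Vᵀ * R) U U' V V' = (LinearMap.ker (facTangent hL hR))ᗮ := by
      rw [nullBar_eq_ker_orthogonal hL hR hsvd, ker_facTangent]
    let e := (LinearEquiv.ofEq _ _ hbar).trans
      (kerOrthogonalEquiv (facTangent hL hR) (facTangent_surjective hL hR))
    have he : ∀ A, e A = facTangent hL hR A := fun A => rfl
    refine ⟨fun A => ⟨by rw [hxi]; exact facDeriv_mem_tangentSpace A hL hR, ?_⟩,
      ⟨e, fun A => (hxi A).symm, fun ξ => ?_⟩, ?_,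
      ⟨(facTangent hL hR).domRestrict _, fun A => (hxi A).symm, fun ξ => ?_, fun A => hform A⟩, ?_⟩
    · simp only [hxi]
      exact hform A
    · have hmem : (e.symm ξ : Matrix (Fin p₁ ⊕ Fin p₂) (Fin r) ℝ) ∈
          (LinearMap.ker (facDeriv L R))ᗮ :=
        nullBar_eq_ker_orthogonal hL hR hsvd ▸ (e.symm ξ).2
      rw [hform, balance_eq_zero_of_mem_orthogonal hL hR hmem, ← he, e.apply_symm_apply]
      simp
    · rw [nullTilde_eq_orbitSpace hL hR hbal hsvd]
      exact hzero
    · exact ⟨⟨e.symm ξ, nullBar_le_nullBarTilde _ _ (e.symm ξ).2⟩, e.apply_symm_apply ξ⟩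
    · rw [nullTilde_eq_orbitSpace hL hR hbal hsvd, hfinN]
  · obtain ⟨H', -, -, heigs⟩ := exists_restrict_orthogonal hHsymm (orbitSpace L R) hzero
    rw [heigs, hfinN, Multiset.count_add, Multiset.count_replicate_self]
    exact Nat.le_add_right _ _
  · intro lam lamBar hlam hlamBar
    have hσ := sigma_nonneg (L * Rᵀ) 1
    have hup := fun {n : ℕ} => norm_mul_sq_le_sigma_mul (n := n) hL hR hbal
    have hlow := fun {n : ℕ} => sigma_mul_le_norm_mul_sq (n := n) hL hR hbal
    -- The kernel of `τ` has dimension `r²`, of which `orbitSpace` takes `(r² - r) / 2`.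
    have hm : finrank ℝ (Matrix (Fin p₁ ⊕ Fin p₂) (Fin r) ℝ) =
        finrank ℝ (tangentSpace (rankManifold p₁ p₂ r) (L * Rᵀ)) + (r ^ 2 + r) / 2 +
          finrank ℝ (orbitSpace L R) := by
      omega
    rw [← hfinN] at hlamBar
    obtain ⟨b1, b2, b3, b4⟩ := eigenvalue_comparison hHsymm hsymm (hdpos.trans_eq hd.symm)
      (facTangent hL hR) (facTangent_surjective hL hR) (orbitSpace L R)
      ((orbitSpace_le_ker hL hR).trans_eq (ker_facTangent hL hR).symm) hzero
      (fun A => μ * ‖balance L R A‖ ^ 2) (b := 2 * sigma (L * Rᵀ) 1 * (4 * μ))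
      (c₀ := sigma (L * Rᵀ) r) (c₁ := 2 * sigma (L * Rᵀ) 1) hform
      (fun A => by positivity)
      (fun A => by
        have := mul_le_mul_of_nonneg_left (norm_balance_sq_le hσ hbal hup A) hμ.le
        linarith)
      (fun A hA => by
        rw [ker_facTangent] at hA
        simp [balance_eq_zero_of_mem_orthogonal hL hR hA])
      (fun A => norm_facDeriv_sq_le hbal hup A)
      (fun A hA => by
        rw [ker_facTangent] at hA
        exact le_norm_facDeriv_sq hL hR hbal hlow hA)
      hm hlam hlamBar
    rw [hd] at b1 b2 b3 b4 hm hfinT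
    refine ⟨b1, fun i h1 hi => b2 i (by omega) (by omega), fun i h1 hi => ?_, fun i h1 hi => ?_⟩
    · rw [mul_add]
      exact b3 i h1 (by omega)
    · have := b4 (i - (r ^ 2 + r) / 2) (by omega) (by omega)
      rwa [Nat.sub_add_cancel (by omega)] at this
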